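/- **Theorem (Doubly-reduced $k$-spectrum).** Let $n\ge 4$, $k\ge 2$, $d\ge 0$. Let $S_{n-2}\le S_n$ be the subgroup of permutations fixing $n-1$ and $n$, and let $f=(f_1,\dots,f_d):S_n/S_{n-2}\to\mathbb{C}^d$, regarded as a right $S_{n-2}$-invariant function on $S_n$. Let $\Lambda_n=\{(n),(n-1,1),(n-2,2),(n-2,1,1)\}$. For $\lambda\in\Lambda_n$ let $\rho=\rho_\lambda$ be Young's orthogonal representation of $S_n$ (matrices in the basis of standard Young tableaux of shape $\lambda$), and put $\tau(\rho)=\frac1{(n-2)!}\sum_{h\in S_{n-2}}\rho(h)$ and $\hat f_i(\rho)=\frac1{n!}\sum_{g\in S_n}f_i(g)\rho(g)$. For $G=(g_1,\dots,g_{k-2})\in S_n^{k-2}$ and $I=(i_1,\dots,i_k)\in[d]^k$ put $$\hat s_{(i_1,\dots,i_{k-1})}(G,\rho)=\Big(\frac1{n!}\sum_{g\in S_n}f_{i_{k-1}}(g)\prod_{l=1}^{k-2}f_{i_l}(g g_l)\,\rho(g)\Big)\tau(\rho),\qquad \hat{\mathcal S}^{(k)}_f(G,\rho)=\bigoplus_{I\in[d]^k}\hat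 s_{(i_1,\dots,i_{k-1})}(G,\rho)^\dagger\,\hat f_{i_k}(\rho).$$ The doubly-reduced $k$-spectrum of $f$ is the collection of the matrices $\hat{\mathcal S}^{(k)}_f(G,\rho_\lambda)$, where $\lambda\in\Lambda_n$ and $G$ runs over the $(k-2)$-element subsets (each listed in the order below) of the set of representatives of $S_{n-2}\backslash S_n/S_{n-2}$ $$(),\ (n-1,n),\ (n-2,n-1),\ (n-2,n),\ (n-2,n-1,n),\ (n-2,n,n-1),\ (n-3,n-1)(n-2,n).$$ There is an absolute constant $C$ such that for all such $n,k,d$: 1. The doubly-reduced $k$-spectrum can be computed in $O(d^{k-1}n^3+d^kn^2)$ operations: there is a straight-line program over $\mathbb{C}$ with at most $C\,(d^{k-1}n^3+d^kn^2)$ operations (reading an input value $f_i(y)$, $y\in S_n/S_{n-2}$; loading a constant; addition; subtraction; multiplication; complex conjugation) such that, for every $f$, each scalar entry of the doubly-reduced $k$-spectrum of $f$ is found at a fixed place among the results of the program, except for entries at fixed positions that vanish for every $f$. 2. For every $f$, the doubly-reduced $k$-spectrum of $f$ has at most $\binom{7}{k-2}\cdot 7\cdot d^k$ non-zero scalar entries.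 -/

import Mathlib

namespace KSpectrum

open Matrix

noncomputable section

/-! ## The symmetric group, the subgroup `S_{n-2}` and the double coset representatives

The symmetric group on `n` letters is `Equiv.Perm (Fin n)`; the letter `i ∈ {1, …, n}` of the
mathematical text is the element `i - 1` of `Fin n`. -/

/-- `S_{n-2}` inside `S_n`: the permutations that fix the last two letters. -/
def subSym (n : ℕ) : Subgroup (Equiv.Perm (Fin n)) :=
  fixingSubgroup (Equiv.Perm (Fin n)) {x : Fin n | n - 2 ≤ (x : ℕ)}

/-- The left cosets `S_n / S_{n-2}`. -/
abbrev Coset (n : ℕ) : Type := Equiv.Perm (Fin n) ⧸ subSym n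

/-- The `i`-th component `f_i : S_n → ℂ` of a function `f : S_n / S_{n-2} → ℂ^d`. -/
def comp {n d : ℕ} (f : Coset n → Fin d → ℂ) (i : Fin d) (g : Equiv.Perm (Fin n)) : ℂ :=
  f (QuotientGroup.mk g) i

/-- The letter `n - j` (counting letters from `1`), for `j = 0, 1, 2, 3`. -/
def letter {n : ℕ} (hn : 4 ≤ n) (j : Fin 4) : Fin n := ⟨n - 1 - j, by omega⟩

/-- The seven representatives of `S_{n-2} \ S_n / S_{n-2}`, in the order `()`, `(n-1, n)`,
`(n-2, n-1)`, `(n-2, n)`, `(n-2, n-1, n)`, `(n-2, n, n-1)`, `(n-3, n-1)(n-2, n)`.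
A three-cycle `(a, b, c)` is the product `(a, b) (b, c)`. -/
def doubleCosetRep {n : ℕ} (hn : 4 ≤ n) : Fin 7 → Equiv.Perm (Fin n) :=
  let w := letter hn
  ![1,
    Equiv.swap (w 1) (w 0),
    Equiv.swap (w 2) (w 1),
    Equiv.swap (w 2) (w 0),
    Equiv.swap (w 2) (w 1) * Equiv.swap (w 1) (w 0),
    Equiv.swap (w 2) (w 0) * Equiv.swap (w 0) (w 1),
    Equiv.swap (w 3) (w 1) * Equiv.swap (w 2) (w 0)]

/-! ## Young's orthogonal representation -/

/-- Standard Young tableaux of shape `μ` with entries `1, …, n`, given by the cell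
`(row, column)` that holds each entry: entries increase strictly along rows and columns. -/
def StdTableau (n : ℕ) (μ : YoungDiagram) : Type :=
  {T : Fin n ≃ {c : ℕ × ℕ // c ∈ μ.cells} //
    (∀ a b, (T a).1.1 = (T b).1.1 → (T a).1.2 < (T b).1.2 → a < b) ∧
    (∀ a b, (T a).1.2 = (T b).1.2 → (T a).1.1 < (T b).1.1 → a < b)}

instance (n : ℕ) (μ : YoungDiagram) : DecidableEq (StdTableau n μ) := by
  unfold StdTableau; infer_instance

instance (n : ℕ) (μ : YoungDiagram) : Fintype (StdTableau n μ) := by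
  unfold StdTableau; infer_instance

/-- The content `column - row` of the cell that holds the entry `a`. -/
def content {n : ℕ} {μ : YoungDiagram} (T : StdTableau n μ) (a : Fin n) : ℤ :=
  ((T.1 a).1.2 : ℤ) - ((T.1 a).1.1 : ℤ)

/-- The smaller letter moved by the `m`-th adjacent transposition. -/
def adjLeft {n : ℕ} (m : Fin (n - 1)) : Fin n := ⟨m, by omega⟩

/-- The larger letter moved by the `m`-th adjacent transposition. -/
def adjRight {n : ℕ} (m : Fin (n - 1)) : Fin n := ⟨m + 1, by omega⟩

/-- The adjacent transposition `(m, m+1)`. -/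
def adjSwap {n : ℕ} (m : Fin (n - 1)) : Equiv.Perm (Fin n) :=
  Equiv.swap (adjLeft m) (adjRight m)

/-- Axial distance from the entry `m` to the entry `m+1` in the tableau `T`. -/
def axialDist {n : ℕ} {μ : YoungDiagram} (T : StdTableau n μ) (m : Fin (n - 1)) : ℤ :=
  content T (adjRight m) - content T (adjLeft m)

/-- The matrix of an adjacent transposition in Young's orthogonal form: on the basis vector `T`
it is `1/r · T + √(1 - 1/r²) · T'`, where `r` is the axial distance and `T'` is `T` with the
entries `m` and `m+1` exchanged (the second term is absent if `T'` is not standard). -/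
def adjMatrix {n : ℕ} (μ : YoungDiagram) (m : Fin (n - 1)) :
    Matrix (StdTableau n μ) (StdTableau n μ) ℂ :=
  Matrix.of fun T' T =>
    if T' = T then ((1 / (axialDist T m : ℝ) : ℝ) : ℂ)
    else if T'.1 = (adjSwap m).trans T.1 then
      ((Real.sqrt (1 - 1 / (axialDist T m : ℝ) ^ 2) : ℝ) : ℂ)
    else 0

/-- Every permutation is a product of adjacent transpositions. -/
theorem exists_word {n : ℕ} (g : Equiv.Perm (Fin n)) :
    ∃ l : List (Fin (n - 1)), (l.map adjSwap).prod = g := by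
  cases n with
  | zero => exact ⟨[], Subsingleton.elim _ _⟩
  | succ n =>
    have h : g ∈ Submonoid.closure
        (Set.range fun i : Fin n => Equiv.swap i.castSucc i.succ) := by
      rw [Equiv.Perm.mclosure_swap_castSucc_succ]; trivial
    induction h using Submonoid.closure_induction with
    | mem x hx =>
      obtain ⟨i, rfl⟩ := hx
      refine ⟨[i], ?_⟩
      rw [List.map_singleton, List.prod_singleton]
      rfl
    | one => exact ⟨[], rfl⟩
    | mul x y _ _ hx hy =>
      obtain ⟨a, rfl⟩ := hx
      obtain ⟨b, rfl⟩ := hy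
      exact ⟨a ++ b, by simp⟩

/-- Young's orthogonal representation `ρ_μ` of `S_n`: write the permutation as a product of
adjacent transpositions and multiply their matrices (the result does not depend on the word,
so that `ρ_μ` is a homomorphism). -/
def yor {n : ℕ} (μ : YoungDiagram) (g : Equiv.Perm (Fin n)) :
    Matrix (StdTableau n μ) (StdTableau n μ) ℂ :=
  ((exists_word g).choose.map (adjMatrix μ)).prod

/-- `Λ_n`: the shapes `(n)`, `(n-1, 1)`, `(n-2, 2)`, `(n-2, 1, 1)`. -/
def Lam (n : ℕ) : Set YoungDiagram :=
  {μ | μ.rowLens = [n] ∨ μ.rowLens = [n - 1, 1] ∨ μ.rowLens = [n - 2, 2] ∨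
    μ.rowLens = [n - 2, 1, 1]}

/-! ## Fourier transform and spectra -/

/-- The Fourier transform `F̂(ρ_μ) = (1 / |S_n|) ∑_g F(g) ρ_μ(g)`. -/
def fourier {n : ℕ} (F : Equiv.Perm (Fin n) → ℂ) (μ : YoungDiagram) :
    Matrix (StdTableau n μ) (StdTableau n μ) ℂ :=
  (1 / (Fintype.card (Equiv.Perm (Fin n)) : ℂ)) • ∑ g, F g • yor μ g

open Classical in
/-- The projection `τ` of `ρ_μ` onto the trivial representation of `S_{n-2}`:
the average of `ρ_μ(h)` over `h ∈ S_{n-2}`. -/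
def tau (n : ℕ) (μ : YoungDiagram) : Matrix (StdTableau n μ) (StdTableau n μ) ℂ :=
  (1 / (Fintype.card (subSym n) : ℂ)) • ∑ h : subSym n, yor μ (h : Equiv.Perm (Fin n))

/-- With `k = m + 2` and `I = (i_1, …, i_k)`: the matrix `r̂_{(i_1, …, i_{k-1})}(G, ρ_μ)`, the
Fourier transform of `g ↦ f_{i_{k-1}}(g) ∏_{l=1}^{k-2} f_{i_l}(g g_l)`.
It does not use the last index `i_k`. -/
def rHat {n d m : ℕ} (f : Coset n → Fin d → ℂ) (I : Fin (m + 2) → Fin d)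
    (G : Fin m → Equiv.Perm (Fin n)) (μ : YoungDiagram) :
    Matrix (StdTableau n μ) (StdTableau n μ) ℂ :=
  fourier (fun g => comp f (I (Fin.last m).castSucc) g *
    ∏ l : Fin m, comp f (I l.castSucc.castSucc) (g * G l)) μ

/-- `ŝ = r̂ τ`. -/
def sHat {n d m : ℕ} (f : Coset n → Fin d → ℂ) (I : Fin (m + 2) → Fin d)
    (G : Fin m → Equiv.Perm (Fin n)) (μ : YoungDiagram) :
    Matrix (StdTableau n μ) (StdTableau n μ) ℂ :=
  rHat f I G μ * tau n μ

/-- The entry at `(G, ρ_μ)` of the reduced `k`-spectrum, `k = m + 2`: the direct sum over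
`I ∈ [d]^k` of the matrices `ŝ_{(i_1, …, i_{k-1})}(G, ρ_μ)† f̂_{i_k}(ρ_μ)`. -/
def reducedSpectrum {n d m : ℕ} (f : Coset n → Fin d → ℂ)
    (G : Fin m → Equiv.Perm (Fin n)) (μ : YoungDiagram) :
    Matrix (StdTableau n μ × (Fin (m + 2) → Fin d)) (StdTableau n μ × (Fin (m + 2) → Fin d)) ℂ :=
  Matrix.blockDiagonal fun I : Fin (m + 2) → Fin d =>
    (sHat f I G μ)ᴴ * fourier (comp f (I (Fin.last (m + 1)))) μ

/-- The positions of the scalar entries of the doubly-reduced `k`-spectrum, `k = m + 2`: a shape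
in `Λ_n`, a choice of `m = k - 2` of the seven double coset representatives without repetition
or order (listed increasingly), and a row and a column of the matrix. -/
structure Position (n d m : ℕ) where
  shape : YoungDiagram
  shape_mem : shape ∈ Lam n
  elems : Fin m ↪o Fin 7
  row : StdTableau n shape × (Fin (m + 2) → Fin d)
  col : StdTableau n shape × (Fin (m + 2) → Fin d)

/-- The doubly-reduced `k`-spectrum, `k = m + 2`, as the family of its scalar entries. -/
def doublyReducedSpectrum {n d m : ℕ} (hn : 4 ≤ n) (f : Coset n → Fin d → ℂ)
    (p : Position n d m) : ℂ :=
  reducedSpectrum f (fun l => doubleCosetRep hn (p.elems l)) p.shape p.row p.col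

/-! ## Operation counts: straight-line programs over `ℂ` -/

/-- One operation. Operands are the numbers of earlier operations, counted from `0`. -/
inductive Op (ι : Type) : Type
  | input (i : ι)
  | const (c : ℂ)
  | add (a b : ℕ)
  | sub (a b : ℕ)
  | mul (a b : ℕ)
  | conj (a : ℕ)

/-- The result of one operation on the input `x`, where `v` lists the results so far
(an operand that does not exist counts as `0`). -/
def Op.eval {ι : Type} (x : ι → ℂ) (v : List ℂ) : Op ι → ℂ
  | .input i => x i
  | .const c => c
  | .add a b => v.getD a 0 + v.getD b 0
  | .sub a b => v.getD a 0 - v.getD b 0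
  | .mul a b => v.getD a 0 * v.getD b 0
  | .conj a => (starRingEnd ℂ) (v.getD a 0)

/-- A straight-line program; its number of operations is its length, so that every operation,
reading an input and loading a constant included, costs `1`. -/
abbrev Program (ι : Type) : Type := List (Op ι)

/-- The list of all results of the program on the input `x`. -/
def Program.run {ι : Type} (P : Program ι) (x : ι → ℂ) : List ℂ :=
  P.foldl (fun v o => v ++ [o.eval x v]) []

/-- `P` computes the family `F` of functions of the input: each coordinate is either declared
to be `0` or found at a fixed place in the list of results, for every input. -/
def Program.Computes {ι κ : Type} (P : Program ι) (F : (ι → ℂ) → κ → ℂ) : Prop :=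
  ∃ out : κ → Option ℕ, ∀ x j, F x j = (out j).elim 0 fun r => (P.run x).getD r 0

end

end KSpectrum

/-!
The theorem holds because the doubly-reduced spectrum lives on the `S_{n-2}`-invariant vectors of
the four representations, where everything reduces to sums over pairs of letters.

*Young's orthogonal form.* `yor` is defined through a chosen word, so that it must first be shown to
be a homomorphism. The matrices of the adjacent transpositions satisfy the Coxeter relations
(`adjMatrix_mul_self`, `adjMatrix_comm`, `adjMatrix_braid`), and these relations present the
symmetric group (`CoxeterRel.prod_map_eq_one`). As the matrices are symmetric and real, the
representation is unitary (`yor_conjTranspose`).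

*Sparsity.* Since `f` is right `S_{n-2}`-invariant, each block of the spectrum is `τ (r̂† f̂) τ`
(`sHat_conjTranspose_mul_fourier`). A row of `τ` is a vector fixed by the adjacent transpositions
in `S_{n-2}`, hence vanishes outside the admissible tableaux, those with the letters `1, …, n - 2`
in the first row (`eq_zero_of_not_admissible`). The four shapes have `1, 2, 1, 1` admissible tableaux,
so that each choice of `G` and `I` leaves `1 + 4 + 1 + 1 = 7` positions
(`encard_essential_le`).

*Complexity.* The function `w ↦ (τ ρ(w) τ)_{T' T}` is constant on the double cosets of `S_{n-2}`, so
an entry of `τ (r̂† f̂) τ` is a combination, with coefficients independent of `f`, of the seven sums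
`∑_g conj(f_{i_{k-1}}(g) W(g)) V_D(g)`, where `V_D(g) = ∑_h f_{i_k}(g h g_D)` and
`W(g) = ∑_h ∏_l f_{i_l}(g h g_l)` are sums over `h ∈ S_{n-2}`. Both depend only on the images `x`,
`y` of the last two letters under `g`. Of the seven representatives, six involve at most one further
letter `p`, and only the last involves two, `p` and `q`, through a factor `f_j(q, p)`; the sum over
`q ∉ {x, y, p}` is a precomputed row sum without two terms. So each value of `W` and `V_D` costs
`O(n)` operations (`exists_cosetSum_eq`, `cost_pairSum`), all values of `W` for the `O(d^{k-1})`
choices of indices cost `O(d^{k-1} n^3)`, and each of the `O(d^k)` entries costs `O(n^2)` more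
(`exists_doublyReducedSpectrum_eq`, `cost_entry`). No Fourier transform is computed.
-/

namespace KSpectrum

open Matrix

noncomputable section

/-! ### Words in the Coxeter generators of the symmetric group -/

/-- The Coxeter relations of type `A` for the elements `s 0, …, s (N - 1)` of a monoid. -/
structure CoxeterRel {M : Type*} [Monoid M] (s : ℕ → M) (N : ℕ) : Prop where
  sq : ∀ i, i < N → s i * s i = 1
  comm : ∀ i j, i + 1 < j → j < N → s j * s i = s i * s j
  braid : ∀ i, i + 1 < N → s (i + 1) * s i * s (i + 1) = s i * s (i + 1) * s i

theorem CoxeterRel.mono {M : Type*} [Monoid M] {s : ℕ → M} {N N' : ℕ} (h : CoxeterRel s N)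
    (hN : N' ≤ N) : CoxeterRel s N' :=
  ⟨fun i hi => h.sq i (by omega), fun i j hij hj => h.comm i j hij (by omega),
    fun i hi => h.braid i (by omega)⟩

/-- The descending product `s (j + k - 1) * ⋯ * s (j + 1) * s j`. -/
def descProd {M : Type*} [Monoid M] (s : ℕ → M) (j : ℕ) : ℕ → M
  | 0 => 1
  | k + 1 => s (j + k) * descProd s j k

theorem descProd_succ_right {M : Type*} [Monoid M] (s : ℕ → M) (j k : ℕ) :
    descProd s j (k + 1) = descProd s (j + 1) k * s j := by
  induction k with
  | zero => simp [descProd]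
  | succ k ih =>
    rw [descProd, ih, descProd, ← mul_assoc]
    congr 3
    omega

theorem descProd_mul_of_lt {M : Type*} [Monoid M] {s : ℕ → M} {N : ℕ} (h : CoxeterRel s N)
    {i j k : ℕ} (hij : i + 1 < j) (hk : j + k ≤ N) :
    descProd s j k * s i = s i * descProd s j k := by
  induction k with
  | zero => simp [descProd]
  | succ k ih =>
    rw [descProd, mul_assoc, ih (by omega), ← mul_assoc, h.comm i (j + k) (by omega) (by omega),
      mul_assoc]

theorem mul_descProd_of_lt {M : Type*} [Monoid M] {s : ℕ → M} {N : ℕ} (h : CoxeterRel s N)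
    {i j k : ℕ} (hij : j + k < i) (hi : i < N) :
    descProd s j k * s i = s i * descProd s j k := by
  induction k with
  | zero => simp [descProd]
  | succ k ih =>
    rw [descProd, mul_assoc, ih (by omega), ← mul_assoc, ← h.comm (j + k) i (by omega) (by omega),
      mul_assoc]

/-- Moving `s (i + 1)` across a descending product turns it into `s i`; this is the only use of the
braid relation. -/
theorem descProd_mul_succ {M : Type*} [Monoid M] {s : ℕ → M} {N : ℕ} (h : CoxeterRel s N)
    {i j k : ℕ} (hij : j ≤ i) (hik : i + 1 < j + k) (hk : j + k ≤ N) :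
    descProd s j k * s (i + 1) = s i * descProd s j k := by
  induction k with
  | zero => omega
  | succ k ih =>
    rcases Nat.lt_or_ge (i + 1) (j + k) with hlt | hge
    · rw [descProd, mul_assoc, ih hlt (by omega), ← mul_assoc,
        h.comm i (j + k) (by omega) (by omega), mul_assoc]
    · obtain ⟨r, rfl⟩ : ∃ r, k = r + 1 := ⟨k - 1, by omega⟩
      obtain rfl : i = j + r := by omega
      rw [descProd, descProd, mul_assoc, mul_assoc,
        mul_descProd_of_lt h (i := j + r + 1) (by omega) (by omega), ← mul_assoc, ← mul_assoc,
        ← mul_assoc, ← mul_assoc]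
      rw [show j + (r + 1) = j + r + 1 by omega, h.braid (j + r) (by omega)]

/-- Every word in `s 0, …, s N` equals a word in `s 0, …, s (N - 1)` times a descending product
`s N * ⋯ * s j`. -/
theorem exists_word_mul_descProd {M : Type*} [Monoid M] {s : ℕ → M} {N : ℕ}
    (h : CoxeterRel s (N + 1)) (l : List ℕ) (hl : ∀ i ∈ l, i < N + 1) :
    ∃ l' : List ℕ, (∀ i ∈ l', i < N) ∧ ∃ j k, j + k = N + 1 ∧
      (l.map s).prod = (l'.map s).prod * descProd s j k := by
  induction l using List.reverseRecOn with
  | nil => exact ⟨[], by simp, N + 1, 0, rfl, by simp [descProd]⟩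
  | append_singleton l i ih =>
    obtain ⟨l', hl', j, k, hjk, e⟩ := ih fun a ha => hl a (by simp [ha])
    have hi : i < N + 1 := hl i (by simp)
    simp only [List.map_append, List.prod_append, List.map_singleton, List.prod_singleton, e,
      mul_assoc]
    rcases lt_trichotomy i j with hij | rfl | hij
    · rcases Nat.lt_or_ge (i + 1) j with hij' | hij'
      · refine ⟨l' ++ [i], ?_, j, k, hjk, ?_⟩
        · intro a ha
          rcases List.mem_append.1 ha with ha | ha
          · exact hl' a ha
          · obtain rfl := List.mem_singleton.1 ha
            omega
        · rw [descProd_mul_of_lt h hij' (by omega)]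
          simp [mul_assoc]
      · obtain rfl : j = i + 1 := by omega
        exact ⟨l', hl', i, k + 1, by omega, by rw [descProd_succ_right]⟩
    · obtain ⟨r, rfl⟩ : ∃ r, k = r + 1 := ⟨k - 1, by omega⟩
      refine ⟨l', hl', i + 1, r, by omega, ?_⟩
      rw [descProd_succ_right, mul_assoc, h.sq i hi, mul_one]
    · obtain ⟨i, rfl⟩ : ∃ r, i = r + 1 := ⟨i - 1, by omega⟩
      refine ⟨l' ++ [i], ?_, j, k, hjk, ?_⟩
      · intro a ha
        rcases List.mem_append.1 ha with ha | ha
        · exact hl' a ha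
        · obtain rfl := List.mem_singleton.1 ha
          omega
      · rw [descProd_mul_succ h (by omega) (by omega) (by omega)]
        simp [mul_assoc]

theorem CoxeterRel.prodMk {M M' : Type*} [Monoid M] [Monoid M'] {s : ℕ → M} {t : ℕ → M'} {N : ℕ}
    (hs : CoxeterRel s N) (ht : CoxeterRel t N) : CoxeterRel (fun i => (s i, t i)) N :=
  ⟨fun i hi => Prod.ext (hs.sq i hi) (ht.sq i hi),
    fun i j hij hj => Prod.ext (hs.comm i j hij hj) (ht.comm i j hij hj),
    fun i hi => Prod.ext (hs.braid i hi) (ht.braid i hi)⟩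

theorem coxeterRel_swap {X : Type*} [DecidableEq X] {p : ℕ → X} {N : ℕ}
    (hp : Set.InjOn p (Set.Iic N)) :
    CoxeterRel (fun i => Equiv.swap (p i) (p (i + 1))) N := by
  have ne : ∀ i j, i ≤ N → j ≤ N → i ≠ j → p i ≠ p j := fun i j hi hj hij e => hij (hp hi hj e)
  refine ⟨fun i _ => Equiv.swap_mul_self _ _, fun i j hij hj => ?_, fun i hi => ?_⟩
  · rw [Equiv.mul_swap_eq_swap_mul,
      Equiv.swap_apply_of_ne_of_ne (ne _ _ (by omega) (by omega) (by omega))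
        (ne _ _ (by omega) (by omega) (by omega)),
      Equiv.swap_apply_of_ne_of_ne (ne _ _ (by omega) (by omega) (by omega))
        (ne _ _ (by omega) (by omega) (by omega))]
  · rw [Equiv.mul_swap_eq_swap_mul, mul_assoc]
    congr 1
    rw [Equiv.Perm.mul_apply, Equiv.Perm.mul_apply, Equiv.swap_apply_right,
      Equiv.swap_apply_of_ne_of_ne (ne _ _ (by omega) (by omega) (by omega))
        (ne _ _ (by omega) (by omega) (by omega)),
      Equiv.swap_apply_of_ne_of_ne (ne _ _ (by omega) (by omega) (by omega))
        (ne _ _ (by omega) (by omega) (by omega)), Equiv.swap_apply_right]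

theorem descProd_swap_apply {X : Type*} [DecidableEq X] (p : ℕ → X) (j k : ℕ) :
    descProd (fun i => Equiv.swap (p i) (p (i + 1))) j k (p j) = p (j + k) := by
  induction k with
  | zero => rfl
  | succ k ih =>
    rw [descProd, Equiv.Perm.mul_apply, ih, Equiv.swap_apply_left]
    rfl

theorem prod_map_swap_apply {X : Type*} [DecidableEq X] {p : ℕ → X} {N : ℕ}
    (hp : Set.InjOn p (Set.Iic N)) {N' : ℕ} (hN : N' < N) (l : List ℕ)
    (hl : ∀ i ∈ l, i < N') :
    (l.map fun i => Equiv.swap (p i) (p (i + 1))).prod (p (N' + 1)) = p (N' + 1) := by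
  induction l with
  | nil => rfl
  | cons i l ih =>
    have hi := hl i (by simp)
    rw [List.map_cons, List.prod_cons, Equiv.Perm.mul_apply, ih fun a ha => hl a (by simp [ha])]
    refine Equiv.swap_apply_of_ne_of_ne ?_ ?_ <;> intro e <;>
      have := hp (show _ ≤ N by omega) (show _ ≤ N by omega) e <;> omega

/-- The Coxeter relations present the symmetric group: a word in the adjacent transpositions with
trivial product has trivial product in every monoid whose generators satisfy the relations. -/
theorem CoxeterRel.prod_map_eq_one {M X : Type*} [Monoid M] [DecidableEq X] {s : ℕ → M} {N : ℕ}
    (h : CoxeterRel s N) {p : ℕ → X} (hp : Set.InjOn p (Set.Iic N)) (l : List ℕ)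
    (hl : ∀ i ∈ l, i < N) (h1 : (l.map fun i => Equiv.swap (p i) (p (i + 1))).prod = 1) :
    (l.map s).prod = 1 := by
  induction N generalizing l with
  | zero =>
    cases l with
    | nil => rfl
    | cons i l => exact absurd (hl i (by simp)) (by omega)
  | succ N ih =>
    -- Reduce the word in both groups at once, by working in the product monoid.
    obtain ⟨l', hl', j, k, hjk, e⟩ :=
      exists_word_mul_descProd (h.prodMk (coxeterRel_swap hp)) l hl
    have fst : ∀ w : List ℕ, (w.map fun i => (s i, Equiv.swap (p i) (p (i + 1)))).prod
        = ((w.map s).prod, (w.map fun i => Equiv.swap (p i) (p (i + 1))).prod) := by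
      intro w
      induction w with
      | nil => rfl
      | cons a w ihw => simp [ihw]
    have dsc : ∀ k, descProd (fun i => (s i, Equiv.swap (p i) (p (i + 1)))) j k
        = (descProd s j k, descProd (fun i => Equiv.swap (p i) (p (i + 1))) j k) := by
      intro k
      induction k with
      | zero => rfl
      | succ k ihk => simp [descProd, ihk]
    rw [fst, fst, dsc] at e
    have e1 := congrArg Prod.fst e
    have e2 := congrArg Prod.snd e
    simp only [Prod.mk_mul_mk] at e1 e2
    -- The image of the point `p j` shows that the descending product is empty.
    have hk : k = 0 := by
      have := congrArg (fun g : Equiv.Perm X => g (p j)) (h1.symm.trans e2)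
      simp only [Equiv.Perm.mul_apply, descProd_swap_apply, hjk] at this
      rw [prod_map_swap_apply hp (by omega) l' hl'] at this
      have := hp (show j ≤ N + 1 by omega) (show N + 1 ≤ N + 1 by omega) this
      omega
    subst hk
    rw [e1, descProd, mul_one]
    rw [descProd, mul_one] at e2
    exact ih (h.mono (by omega)) (hp.mono (Set.Iic_subset_Iic.2 (by omega))) l' hl'
      (e2.symm.trans h1)

/-! ### Young's orthogonal form is a representation -/

/-- A filling of the cells of `μ` with the letters `0, …, n - 1`, standard or not. -/
abbrev Filling (n : ℕ) (μ : YoungDiagram) : Type := Fin n ≃ {c : ℕ × ℕ // c ∈ μ.cells}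

/-- A filling is standard if its entries increase along rows and columns. -/
def IsStd {n : ℕ} {μ : YoungDiagram} (F : Filling n μ) : Prop :=
  (∀ a b, (F a).1.1 = (F b).1.1 → (F a).1.2 < (F b).1.2 → a < b) ∧
    (∀ a b, (F a).1.2 = (F b).1.2 → (F a).1.1 < (F b).1.1 → a < b)

/-- The content of the cell that holds `a`. -/
def cont {n : ℕ} {μ : YoungDiagram} (F : Filling n μ) (a : Fin n) : ℤ :=
  ((F a).1.2 : ℤ) - ((F a).1.1 : ℤ)

/-- The filling with the entries `m` and `m + 1` exchanged. -/
def swapF {n : ℕ} {μ : YoungDiagram} (m : Fin (n - 1)) (F : Filling n μ) : Filling n μ :=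
  (adjSwap m).trans F

/-- The basis vector of a standard filling; the zero vector if the filling is not standard. -/
def fillVec {n : ℕ} {μ : YoungDiagram} (F : Filling n μ) : StdTableau n μ → ℂ :=
  fun T => if T.1 = F then 1 else 0

/-- The off-diagonal coefficient `√(1 - 1/r²)` of Young's orthogonal form. -/
def offCoeff (r : ℤ) : ℂ := ((Real.sqrt (1 - 1 / (r : ℝ) ^ 2) : ℝ) : ℂ)

theorem offCoeff_neg (r : ℤ) : offCoeff (-r) = offCoeff r := by
  simp [offCoeff]

theorem offCoeff_mul_self {r : ℤ} (hr : r ≠ 0) : offCoeff r * offCoeff r = 1 - 1 / (r : ℂ) ^ 2 := by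
  have h1 : (1 : ℝ) ≤ (r : ℝ) ^ 2 := by
    have : 1 ≤ r ^ 2 := by have := sq_nonneg r; have := pow_ne_zero 2 hr; omega
    exact_mod_cast this
  have h2 : (0 : ℝ) ≤ 1 - 1 / (r : ℝ) ^ 2 := by
    rw [sub_nonneg, div_le_one (by linarith)]
    exact h1
  rw [offCoeff, ← Complex.ofReal_mul, Real.mul_self_sqrt h2]
  push_cast
  ring

theorem offCoeff_of_sq_eq_one {r : ℤ} (hr : r = 1 ∨ r = -1) : offCoeff r = 0 := by
  rcases hr with rfl | rfl <;> simp [offCoeff]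

section Fillings

variable {n : ℕ} {μ : YoungDiagram}

theorem fillVec_eq_zero {F : Filling n μ} (h : ¬ IsStd F) : fillVec F = 0 := by
  funext T
  have : T.1 ≠ F := fun e => h (e ▸ T.2)
  simp [fillVec, this]

theorem stdTableau_ext_iff {T T' : StdTableau n μ} : T = T' ↔ T.1 = T'.1 := Subtype.ext_iff

/-- A standard filling, as a standard tableau. -/
def IsStd.tableau {F : Filling n μ} (h : IsStd F) : StdTableau n μ := ⟨F, h⟩

theorem fillVec_std (T : StdTableau n μ) : fillVec T.1 = Pi.single T (1 : ℂ) := by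
  funext T'
  simp [fillVec, Pi.single_apply, stdTableau_ext_iff]

theorem cell_mem_of_le (F : Filling n μ) (a : Fin n) {i j : ℕ} (hi : i ≤ (F a).1.1)
    (hj : j ≤ (F a).1.2) : (i, j) ∈ μ.cells :=
  μ.mem_cells _ |>.2 (μ.up_left_mem hi hj ((μ.mem_cells _).1 (F a).2))

/-- The entry of a filling at a cell. -/
theorem exists_entry (F : Filling n μ) {i j : ℕ} (h : (i, j) ∈ μ.cells) :
    ∃ a, (F a).1 = (i, j) := ⟨F.symm ⟨_, h⟩, by simp⟩

theorem filling_ext_cell (F : Filling n μ) {a b : Fin n} (h1 : (F a).1.1 = (F b).1.1)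
    (h2 : (F a).1.2 = (F b).1.2) : a = b :=
  F.injective (Subtype.ext (Prod.ext h1 h2))

/-- Entries of a standard filling increase to the south-east. -/
theorem IsStd.le_of_le {F : Filling n μ} (h : IsStd F) {a b : Fin n}
    (h1 : (F a).1.1 ≤ (F b).1.1) (h2 : (F a).1.2 ≤ (F b).1.2) : a ≤ b := by
  obtain ⟨c, hc⟩ := exists_entry F (cell_mem_of_le F b h1 le_rfl)
  have ac : a ≤ c := by
    rcases h2.lt_or_eq with h2 | h2
    · exact (h.1 a c (by simp [hc]) (by simpa [hc] using h2)).le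
    · exact (filling_ext_cell F (by simp [hc]) (by simp [hc, h2])).le
  have cb : c ≤ b := by
    rcases h1.lt_or_eq with h1 | h1
    · exact (h.2 c b (by simp [hc]) (by simpa [hc] using h1)).le
    · exact (filling_ext_cell F (by simp [hc, h1]) (by simp [hc])).le
  exact ac.trans cb

/-- Two distinct entries on a common diagonal of a standard filling differ by at least three. -/
theorem IsStd.cont_ne {F : Filling n μ} (h : IsStd F) {a b : Fin n} (hab : a < b)
    (hb : (b : ℕ) ≤ a + 2) : cont F b ≠ cont F a := by
  intro e
  have hlt : (F a).1.1 < (F b).1.1 ∧ (F a).1.2 < (F b).1.2 := by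
    unfold cont at e
    rcases Nat.lt_or_ge (F a).1.1 (F b).1.1 with h1 | h1
    · exact ⟨h1, by omega⟩
    · exact absurd (h.le_of_le h1 (by omega : (F b).1.2 ≤ (F a).1.2)) (not_le.2 hab)
  -- The other two corners of the rectangle spanned by the two cells hold two letters in between.
  obtain ⟨c, hc⟩ := exists_entry F (cell_mem_of_le F b hlt.1.le le_rfl)
  obtain ⟨d, hd⟩ := exists_entry F (cell_mem_of_le F b le_rfl hlt.2.le)
  have ac : a < c := h.1 a c (by simp [hc]) (by simpa [hc] using hlt.2)
  have cb : c < b := h.2 c b (by simp [hc]) (by simpa [hc] using hlt.1)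
  have ad : a < d := h.2 a d (by simp [hd]) (by simpa [hd] using hlt.1)
  have db : d < b := h.1 d b (by simp [hd]) (by simpa [hd] using hlt.2)
  have : c = d := by
    apply Fin.ext
    have := Fin.lt_def.1 ac; have := Fin.lt_def.1 cb
    have := Fin.lt_def.1 ad; have := Fin.lt_def.1 db
    omega
  rw [this, hd] at hc
  have := (Prod.ext_iff.1 hc).1
  simp only at this
  omega

theorem adjSwap_left (m : Fin (n - 1)) : adjSwap m (adjLeft m) = adjRight m :=
  Equiv.swap_apply_left _ _

theorem adjSwap_right (m : Fin (n - 1)) : adjSwap m (adjRight m) = adjLeft m :=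
  Equiv.swap_apply_right _ _

theorem adjSwap_of_ne {m : Fin (n - 1)} {a : Fin n} (h1 : (a : ℕ) ≠ m) (h2 : (a : ℕ) ≠ m + 1) :
    adjSwap m a = a :=
  Equiv.swap_apply_of_ne_of_ne (fun e => h1 (congrArg Fin.val e)) fun e => h2 (congrArg Fin.val e)

theorem adjSwap_mul_self (m : Fin (n - 1)) : adjSwap m * adjSwap m = 1 :=
  Equiv.swap_mul_self _ _

theorem swapF_swapF (m : Fin (n - 1)) (F : Filling n μ) : swapF m (swapF m F) = F := by
  ext a : 1
  exact congrArg F (Equiv.swap_apply_self _ _ a)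

theorem swapF_ne (m : Fin (n - 1)) (F : Filling n μ) : swapF m F ≠ F := by
  intro e
  have : F (adjSwap m (adjLeft m)) = F (adjLeft m) :=
    congrArg (fun G : Filling n μ => G (adjLeft m)) e
  rw [adjSwap_left] at this
  have := F.injective this
  have := congrArg Fin.val this
  simp [adjLeft, adjRight] at this

/-- The axial distance from `m` to `m + 1` in a filling. -/
def axial (F : Filling n μ) (m : Fin (n - 1)) : ℤ := cont F (adjRight m) - cont F (adjLeft m)

theorem cont_swapF (m : Fin (n - 1)) (F : Filling n μ) (a : Fin n) :
    cont (swapF m F) a = cont F (adjSwap m a) := rfl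

theorem axial_swapF (m : Fin (n - 1)) (F : Filling n μ) : axial (swapF m F) m = - axial F m := by
  simp [axial, cont_swapF, adjSwap_left, adjSwap_right]

theorem IsStd.axial_ne_zero {F : Filling n μ} (h : IsStd F) (m : Fin (n - 1)) : axial F m ≠ 0 :=
  sub_ne_zero.2 (h.cont_ne (Fin.lt_def.2 (by simp [adjLeft, adjRight]))
    (by simp [adjLeft, adjRight]))

/-- Exchanging `m` and `m + 1` keeps a filling standard if they lie in different rows and
different columns. -/
theorem IsStd.swapF {F : Filling n μ} (h : IsStd F) {m : Fin (n - 1)}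
    (h1 : (F (adjLeft m)).1.1 ≠ (F (adjRight m)).1.1)
    (h2 : (F (adjLeft m)).1.2 ≠ (F (adjRight m)).1.2) : IsStd (swapF m F) := by
  -- The transposition preserves the order of all pairs of letters except `m`, `m + 1`.
  have key : ∀ a b : Fin n, adjSwap m a < adjSwap m b →
      ¬ (adjSwap m a = adjLeft m ∧ adjSwap m b = adjRight m) → a < b := by
    intro a b hlt hne
    by_contra hba
    by_cases e : a = b
    · subst e; exact lt_irrefl _ hlt
    have hba : b < a := lt_of_le_of_ne (not_lt.1 hba) (Ne.symm e)
    have hv : ∀ c : Fin n, ((c : ℕ) = m ∧ adjSwap m c = adjRight m) ∨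
        ((c : ℕ) = m + 1 ∧ adjSwap m c = adjLeft m) ∨
        ((c : ℕ) ≠ m ∧ (c : ℕ) ≠ m + 1 ∧ adjSwap m c = c) := by
      intro c
      by_cases c1 : (c : ℕ) = m
      · obtain rfl : c = adjLeft m := Fin.ext c1
        exact Or.inl ⟨c1, adjSwap_left m⟩
      by_cases c2 : (c : ℕ) = m + 1
      · obtain rfl : c = adjRight m := Fin.ext c2
        exact Or.inr (Or.inl ⟨c2, adjSwap_right m⟩)
      exact Or.inr (Or.inr ⟨c1, c2, adjSwap_of_ne c1 c2⟩)
    have hL : ((adjLeft m : Fin n) : ℕ) = m := rfl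
    have hR : ((adjRight m : Fin n) : ℕ) = m + 1 := rfl
    rw [Fin.lt_def] at hlt hba
    rcases hv a with ⟨a1, a2⟩ | ⟨a1, a2⟩ | ⟨a1, a3, a2⟩ <;>
      rcases hv b with ⟨b1, b2⟩ | ⟨b1, b2⟩ | ⟨b1, b3, b2⟩ <;>
      simp only [a2, b2, hL, hR] at hlt <;>
      omega
  refine ⟨fun a b e hlt => key a b (h.1 _ _ e hlt) ?_, fun a b e hlt => key a b (h.2 _ _ e hlt) ?_⟩
  · rintro ⟨ea, eb⟩
    refine h1 ?_
    rw [← ea, ← eb]; exact e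
  · rintro ⟨ea, eb⟩
    refine h2 ?_
    rw [← ea, ← eb]; exact e

/-- If exchanging `m` and `m + 1` destroys standardness, these entries are neighbours. -/
theorem IsStd.axial_of_not_swapF {F : Filling n μ} (h : IsStd F) {m : Fin (n - 1)}
    (hs : ¬ IsStd (KSpectrum.swapF m F)) : axial F m = 1 ∨ axial F m = -1 := by
  have hlt : adjLeft m < adjRight m := Fin.lt_def.2 (by simp [adjLeft, adjRight])
  have between : ∀ c, ¬ (adjLeft m < c ∧ c < adjRight m) := by
    rintro c ⟨h1, h2⟩
    have h1 := Fin.lt_def.1 h1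
    have h2 := Fin.lt_def.1 h2
    simp only [adjLeft, adjRight] at h1 h2
    omega
  by_cases h1 : (F (adjLeft m)).1.1 = (F (adjRight m)).1.1
  · left
    have hc : (F (adjLeft m)).1.2 < (F (adjRight m)).1.2 := by
      by_contra hc
      exact absurd (h.le_of_le h1.ge (not_lt.1 hc)) (not_le.2 hlt)
    have : (F (adjRight m)).1.2 = (F (adjLeft m)).1.2 + 1 := by
      by_contra hne
      obtain ⟨c, hc'⟩ := exists_entry F
        (cell_mem_of_le F (adjRight m) le_rfl (by omega : (F (adjLeft m)).1.2 + 1 ≤ _))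
      exact between c ⟨h.1 _ _ (by simp [hc', h1]) (by simp [hc']),
        h.1 _ _ (by simp [hc']) (by simp [hc']; omega)⟩
    simp only [axial, cont]
    omega
  by_cases h2 : (F (adjLeft m)).1.2 = (F (adjRight m)).1.2
  · right
    have hc : (F (adjLeft m)).1.1 < (F (adjRight m)).1.1 := by
      by_contra hc
      exact absurd (h.le_of_le (not_lt.1 hc) h2.ge) (not_le.2 hlt)
    have : (F (adjRight m)).1.1 = (F (adjLeft m)).1.1 + 1 := by
      by_contra hne
      obtain ⟨c, hc'⟩ := exists_entry F
        (cell_mem_of_le F (adjRight m) (by omega : (F (adjLeft m)).1.1 + 1 ≤ _) le_rfl)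
      exact between c ⟨h.2 _ _ (by simp [hc', h2]) (by simp [hc']),
        h.2 _ _ (by simp [hc']) (by simp [hc']; omega)⟩
    simp only [axial, cont]
    omega
  exact absurd (h.swapF h1 h2) hs

/-- Young's orthogonal form, on the vectors of all fillings: no case distinction is needed, because
the off-diagonal coefficient vanishes when exactly one of the two fillings is standard. -/
theorem adjMatrix_mulVec (m : Fin (n - 1)) (F : Filling n μ) :
    adjMatrix μ m *ᵥ fillVec F =
      (1 / (axial F m : ℂ)) • fillVec F + offCoeff (axial F m) • fillVec (swapF m F) := by
  by_cases hF : IsStd F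
  · have : fillVec F = Pi.single hF.tableau (1 : ℂ) := fillVec_std hF.tableau
    rw [this, Matrix.mulVec_single_one, ← this]
    funext T
    simp only [adjMatrix, Matrix.col_apply, Matrix.of_apply, Pi.add_apply, Pi.smul_apply, fillVec,
      smul_eq_mul, stdTableau_ext_iff]
    have hT : hF.tableau.1 = F := rfl
    have hax : axialDist hF.tableau m = axial F m := rfl
    rw [hax, hT]
    by_cases e : T.1 = F
    · have : F ≠ swapF m F := (swapF_ne m F).symm
      simp [e, this]
    · by_cases e' : T.1 = swapF m F
      · have : T.1 = (adjSwap m).trans F := e'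
        rw [if_neg e, if_pos this, if_neg e, if_pos e', offCoeff]
        simp
      · have : T.1 ≠ (adjSwap m).trans F := e'
        rw [if_neg e, if_neg this, if_neg e, if_neg e']
        simp
  · by_cases hs : IsStd (swapF m F)
    · have h1 := hs.axial_of_not_swapF (m := m) (by rwa [swapF_swapF])
      rw [axial_swapF] at h1
      rw [fillVec_eq_zero hF, offCoeff_of_sq_eq_one (by omega)]
      simp
    · simp [fillVec_eq_zero hF, fillVec_eq_zero hs]

/-- A matrix is determined by its action on the vectors of standard fillings. -/
theorem matrix_ext_fillVec {A B : Matrix (StdTableau n μ) (StdTableau n μ) ℂ}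
    (h : ∀ F : Filling n μ, IsStd F → A *ᵥ fillVec F = B *ᵥ fillVec F) : A = B := by
  refine Matrix.ext_of_mulVec_single fun T => ?_
  have := h T.1 T.2
  rwa [fillVec_std] at this

theorem adjMatrix_mul_self (m : Fin (n - 1)) : adjMatrix μ m * adjMatrix μ m = 1 := by
  refine matrix_ext_fillVec fun F hF => ?_
  have hr := hF.axial_ne_zero m
  have hr' : (axial F m : ℂ) ≠ 0 := by exact_mod_cast hr
  rw [← Matrix.mulVec_mulVec, adjMatrix_mulVec, Matrix.mulVec_add, Matrix.mulVec_smul,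
    Matrix.mulVec_smul, adjMatrix_mulVec, adjMatrix_mulVec, swapF_swapF, axial_swapF, offCoeff_neg,
    Matrix.one_mulVec]
  have h2 := offCoeff_mul_self hr
  ext T
  simp only [Pi.add_apply, Pi.smul_apply, smul_eq_mul]
  push_cast
  field_simp at h2 ⊢
  linear_combination (fillVec F T) * h2

theorem adjMatrix_comm {i j : Fin (n - 1)} (hij : (i : ℕ) + 1 < j) :
    adjMatrix μ j * adjMatrix μ i = adjMatrix μ i * adjMatrix μ j := by
  have e1 : adjSwap j (adjLeft i) = adjLeft i :=
    adjSwap_of_ne (by simp [adjLeft]; omega) (by simp [adjLeft]; omega)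
  have e2 : adjSwap j (adjRight i) = adjRight i :=
    adjSwap_of_ne (by simp [adjRight]; omega) (by simp [adjRight]; omega)
  have e3 : adjSwap i (adjLeft j) = adjLeft j :=
    adjSwap_of_ne (by simp [adjLeft]; omega) (by simp [adjLeft]; omega)
  have e4 : adjSwap i (adjRight j) = adjRight j :=
    adjSwap_of_ne (by simp [adjRight]; omega) (by simp [adjRight]; omega)
  have e5 : adjSwap j * adjSwap i = adjSwap i * adjSwap j := by
    conv_lhs => rw [adjSwap.eq_1 i]
    rw [Equiv.mul_swap_eq_swap_mul, e1, e2]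
    rfl
  refine matrix_ext_fillVec fun F hF => ?_
  have a1 : axial (swapF i F) j = axial F j := by simp [axial, cont_swapF, e3, e4]
  have a2 : axial (swapF j F) i = axial F i := by simp [axial, cont_swapF, e1, e2]
  have a3 : swapF j (swapF i F) = swapF i (swapF j F) := by
    ext a : 1
    exact congrArg F (congrArg (fun g : Equiv.Perm (Fin n) => g a) e5.symm)
  rw [← Matrix.mulVec_mulVec, ← Matrix.mulVec_mulVec]
  simp only [adjMatrix_mulVec, Matrix.mulVec_add, Matrix.mulVec_smul, a1, a2, a3]
  module

theorem adjMatrix_braid {i j : Fin (n - 1)} (hij : (j : ℕ) = i + 1) :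
    adjMatrix μ j * adjMatrix μ i * adjMatrix μ j =
      adjMatrix μ i * adjMatrix μ j * adjMatrix μ i := by
  have e0 : adjLeft j = adjRight i := Fin.ext (by simp [adjLeft, adjRight, hij])
  have e1 : adjSwap j (adjLeft i) = adjLeft i :=
    adjSwap_of_ne (by simp [adjLeft]; omega) (by simp [adjLeft]; omega)
  have e2 : adjSwap i (adjRight j) = adjRight j :=
    adjSwap_of_ne (by simp [adjRight]; omega) (by simp [adjRight]; omega)
  have e3 := adjSwap_left i
  have e4 := adjSwap_right i
  have e5 := adjSwap_left j
  have e6 := adjSwap_right j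
  rw [e0] at e5 e6
  have e7 : adjSwap j * adjSwap i * adjSwap j = adjSwap i * adjSwap j * adjSwap i := by
    have h1 : adjSwap i * adjSwap j * adjSwap i
        = adjSwap j * (adjSwap i * adjSwap j) := by
      have h := Equiv.mul_swap_eq_swap_mul (adjSwap i * adjSwap j) (adjLeft i) (adjRight i)
      have hj : adjSwap j = Equiv.swap (adjRight i) (adjRight j) := by rw [← e0]; rfl
      rw [Equiv.Perm.mul_apply, Equiv.Perm.mul_apply, e1, e3, e5, e2, ← hj] at h
      exact h
    rw [h1, mul_assoc]
  refine matrix_ext_fillVec fun F hF => ?_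
  set x := cont F (adjLeft i) with hx
  set y := cont F (adjRight i) with hy
  set z := cont F (adjRight j) with hz
  have a3 : swapF j (swapF i (swapF j F)) = swapF i (swapF j (swapF i F)) := by
    ext a : 1
    exact congrArg F (congrArg (fun g : Equiv.Perm (Fin n) => g a) e7)
  have hp : y - x ≠ 0 := hF.axial_ne_zero i
  have hq : z - y ≠ 0 := by
    have := hF.axial_ne_zero j
    rwa [axial, e0] at this
  have hpq : z - x ≠ 0 :=
    sub_ne_zero.2 (hF.cont_ne (Fin.lt_def.2 (by simp [adjLeft, adjRight]; omega))
      (by simp [adjLeft, adjRight]; omega))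
  rw [← Matrix.mulVec_mulVec, ← Matrix.mulVec_mulVec, ← Matrix.mulVec_mulVec,
    ← Matrix.mulVec_mulVec]
  simp only [adjMatrix_mulVec, Matrix.mulVec_add, Matrix.mulVec_smul, a3, axial, cont_swapF, e0,
    e1, e2, e3, e4, e5, e6, swapF_swapF, ← hx, ← hy, ← hz]
  have n1 : offCoeff (x - y) = offCoeff (y - x) := by rw [← offCoeff_neg, neg_sub]
  have n2 : offCoeff (y - z) = offCoeff (z - y) := by rw [← offCoeff_neg, neg_sub]
  rw [n1, n2]
  have s1 := offCoeff_mul_self hp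
  have s2 := offCoeff_mul_self hq
  have hp' : ((y : ℂ) - x) ≠ 0 := by exact_mod_cast hp
  have hq' : ((z : ℂ) - y) ≠ 0 := by exact_mod_cast hq
  have hpq' : ((z : ℂ) - x) ≠ 0 := by exact_mod_cast hpq
  have i1 : 1 / ((x : ℂ) - y) = -(1 / ((y : ℂ) - x)) := by rw [← neg_sub, div_neg]
  have i2 : 1 / ((y : ℂ) - z) = -(1 / ((z : ℂ) - y)) := by rw [← neg_sub, div_neg]
  -- The relation between the three reciprocal axial distances behind the braid relation.
  have i3 : 1 / ((y : ℂ) - x) * (1 / ((z : ℂ) - y)) =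
      1 / ((z : ℂ) - x) * (1 / ((y : ℂ) - x) + 1 / ((z : ℂ) - y)) := by
    field_simp
    ring
  ext T
  simp only [Pi.add_apply, Pi.smul_apply, smul_eq_mul]
  push_cast at s1 s2 ⊢
  rw [i1, i2]
  rw [← _root_.one_div_pow] at s1 s2
  generalize 1 / ((y : ℂ) - x) = α at *
  generalize 1 / ((z : ℂ) - y) = β at *
  generalize 1 / ((z : ℂ) - x) = γ at *
  generalize offCoeff (y - x) = a at *
  generalize offCoeff (z - y) = b at *
  linear_combination fillVec F T * γ * (s2 - s1) +
    ((β - α) * fillVec F T + b * fillVec (swapF j F) T - a * fillVec (swapF i F) T) * i3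

theorem adjMatrix_transpose (m : Fin (n - 1)) : (adjMatrix μ m)ᵀ = adjMatrix μ m := by
  ext T T'
  rw [Matrix.transpose_apply]
  simp only [adjMatrix, Matrix.of_apply]
  by_cases e : T = T'
  · subst e; rfl
  rw [if_neg e, if_neg (Ne.symm e)]
  have h : (T'.1 = (adjSwap m).trans T.1) ↔ (T.1 = (adjSwap m).trans T'.1) :=
    ⟨fun h => by rw [h]; exact (swapF_swapF m T.1).symm,
      fun h => by rw [h]; exact (swapF_swapF m T'.1).symm⟩
  by_cases e' : T'.1 = (adjSwap m).trans T.1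
  · rw [if_pos e', if_pos (h.1 e')]
    have : axialDist T' m = - axialDist T m := by
      have := axial_swapF m T.1
      rwa [show swapF m T.1 = T'.1 from e'.symm] at this
    rw [this]
    simp
  · rw [if_neg e', if_neg (h.not.1 e')]

theorem adjMatrix_conjTranspose (m : Fin (n - 1)) : (adjMatrix μ m)ᴴ = adjMatrix μ m := by
  conv_rhs => rw [← adjMatrix_transpose]
  ext T T'
  rw [Matrix.conjTranspose_apply, Matrix.transpose_apply]
  simp only [adjMatrix, Matrix.of_apply]
  split_ifs <;> simp only [Complex.star_def, Complex.conj_ofReal, map_zero]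

/-- The matrix of a word depends only on the permutation that the word represents. -/
theorem prod_adjMatrix_congr {l l' : List (Fin (n - 1))}
    (h : (l.map adjSwap).prod = (l'.map adjSwap).prod) :
    (l.map (adjMatrix μ)).prod = (l'.map (adjMatrix μ)).prod := by
  rcases Nat.eq_zero_or_pos (n - 1) with hn | hn
  · have : ∀ w : List (Fin (n - 1)), w = [] := by
      rintro (_ | ⟨a, w⟩)
      · rfl
      · exact absurd a.2 (by omega)
    rw [this l, this l']
  -- Generators and letters are indexed by all natural numbers, with junk beyond the range in use.
  let p : ℕ → Fin n := fun i => ⟨min i (n - 1), by omega⟩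
  have hp : Set.InjOn p (Set.Iic (n - 1)) := by
    intro i hi j hj e
    have := congrArg Fin.val e
    simp only [p, Set.mem_Iic] at this hi hj
    omega
  have hsw : ∀ m : Fin (n - 1), Equiv.swap (p m) (p (m + 1)) = adjSwap m := by
    intro m
    have h1 : p m = adjLeft m := Fin.ext (by simp [p, adjLeft])
    have h2 : p (m + 1) = adjRight m := Fin.ext (by simp [p, adjRight])
    rw [h1, h2]; rfl
  let s : ℕ → Matrix (StdTableau n μ) (StdTableau n μ) ℂ :=
    fun i => if h : i < n - 1 then adjMatrix μ ⟨i, h⟩ else 1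
  have hs : ∀ m : Fin (n - 1), s m = adjMatrix μ m := fun m => by simp [s]
  have rel : CoxeterRel s (n - 1) := by
    refine ⟨fun i hi => ?_, fun i j hij hj => ?_, fun i hi => ?_⟩
    · simp only [s, hi, dif_pos]
      exact adjMatrix_mul_self _
    · simp only [s, hj, show i < n - 1 by omega, dif_pos]
      exact adjMatrix_comm hij
    · simp only [s, hi, show i < n - 1 by omega, dif_pos]
      exact adjMatrix_braid rfl
  have h1 : ∀ w : List (Fin (n - 1)), (w.map adjSwap).prod = 1 →
      (w.map (adjMatrix μ)).prod = 1 := by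
    intro w hw
    have := rel.prod_map_eq_one hp (w.map Fin.val) (by simp)
      (by simpa only [List.map_map, Function.comp_def, hsw] using hw)
    simpa only [List.map_map, Function.comp_def, hs] using this
  have rev : ∀ w : List (Fin (n - 1)),
      (w.reverse.map (adjMatrix μ)).prod * (w.map (adjMatrix μ)).prod = 1 ∧
      (w.map adjSwap).prod * (w.reverse.map adjSwap).prod = 1 := by
    intro w
    induction w with
    | nil => simp
    | cons a w ih =>
      constructor
      · simp only [List.reverse_cons, List.map_append, List.prod_append, List.map_cons,
          List.prod_cons, List.map_nil, List.prod_nil, mul_one]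
        rw [mul_assoc, ← mul_assoc (adjMatrix μ a), adjMatrix_mul_self, one_mul, ih.1]
      · simp only [List.reverse_cons, List.map_append, List.prod_append, List.map_cons,
          List.prod_cons, List.map_nil, List.prod_nil, mul_one]
        rw [mul_assoc, ← mul_assoc _ _ (adjSwap a), ih.2, one_mul, adjSwap_mul_self]
  have h2 := h1 (l ++ l'.reverse) (by
    rw [List.map_append, List.prod_append, h, (rev l').2])
  rw [List.map_append, List.prod_append] at h2
  rw [← mul_one (l.map (adjMatrix μ)).prod, ← (rev l').1, ← mul_assoc, h2, one_mul]

theorem yor_prod (l : List (Fin (n - 1))) :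
    yor μ (l.map adjSwap).prod = (l.map (adjMatrix μ)).prod :=
  prod_adjMatrix_congr (exists_word _).choose_spec

theorem yor_one : yor μ (1 : Equiv.Perm (Fin n)) = 1 := yor_prod []

theorem yor_adjSwap (m : Fin (n - 1)) : yor μ (adjSwap m) = adjMatrix μ m := by
  simpa using yor_prod (μ := μ) [m]

theorem yor_mul (g h : Equiv.Perm (Fin n)) : yor μ (g * h) = yor μ g * yor μ h := by
  obtain ⟨l, rfl⟩ := exists_word g
  obtain ⟨l', rfl⟩ := exists_word h
  rw [← List.prod_append, ← List.map_append, yor_prod, yor_prod, yor_prod, List.map_append,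
    List.prod_append]

/-- Young's orthogonal representation is unitary. -/
theorem yor_conjTranspose (g : Equiv.Perm (Fin n)) : (yor μ g)ᴴ = yor μ g⁻¹ := by
  obtain ⟨l, rfl⟩ := exists_word g
  induction l with
  | nil => simp [yor_one]
  | cons m l ih =>
    rw [List.map_cons, List.prod_cons, yor_mul, Matrix.conjTranspose_mul, ih, yor_adjSwap,
      adjMatrix_conjTranspose, _root_.mul_inv_rev, yor_mul, ← yor_adjSwap]
    congr 2

end Fillings

/-! ### The projection onto the `S_{n-2}`-invariants -/

section Tau

variable {n : ℕ} {μ : YoungDiagram}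

theorem mem_subSym {g : Equiv.Perm (Fin n)} :
    g ∈ subSym n ↔ ∀ x : Fin n, n - 2 ≤ (x : ℕ) → g x = x := by
  simp [subSym, mem_fixingSubgroup_iff]

theorem adjSwap_mem_subSym {m : Fin (n - 1)} (hm : (m : ℕ) + 1 < n - 2) :
    adjSwap m ∈ subSym n :=
  mem_subSym.2 fun x hx => adjSwap_of_ne (by omega) (by omega)

open Classical in
theorem tau_mul_yor {h : Equiv.Perm (Fin n)} (hh : h ∈ subSym n) :
    tau n μ * yor μ h = tau n μ := by
  unfold tau
  rw [Matrix.smul_mul, Finset.sum_mul]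
  congr 1
  refine Fintype.sum_equiv (Equiv.mulRight (⟨h, hh⟩ : subSym n)) _ _ fun g => ?_
  rw [← yor_mul]
  rfl

open Classical in
theorem tau_conjTranspose : (tau n μ)ᴴ = tau n μ := by
  unfold tau
  rw [Matrix.conjTranspose_smul, Matrix.conjTranspose_sum]
  congr 1
  · simp
  · refine Fintype.sum_equiv (Equiv.inv (subSym n)) _ _ fun g => ?_
    rw [yor_conjTranspose]
    rfl

/-- A tableau is *admissible* if the cell in the second row and first column, if there is one, holds
one of the last two letters. Equivalently, all other letters lie in the first row. -/
def Admissible (T : StdTableau n μ) : Prop := ∀ a, (T.1 a).1 = (1, 0) → n - 2 ≤ (a : ℕ)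

/-- A vector fixed by the adjacent transpositions in `S_{n-2}` vanishes at the tableaux that are not
admissible: exchange the entry `a` of the cell `(1, 0)` with `a - 1`, which lies in the first row,
until `a = 1`; there the transposition acts by `-1`. -/
theorem eq_zero_of_not_admissible {v : StdTableau n μ → ℂ}
    (hv : ∀ m : Fin (n - 1), (m : ℕ) + 1 < n - 2 → v ᵥ* adjMatrix μ m = v)
    (T : StdTableau n μ) (hT : ¬ Admissible T) : v T = 0 := by
  simp only [Admissible, not_forall, not_le] at hT
  obtain ⟨a, ha, han⟩ := hT
  obtain ⟨k, hk⟩ : ∃ k, (a : ℕ) = k := ⟨_, rfl⟩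
  induction k using Nat.strong_induction_on generalizing T a with
  | _ k ih =>
  have hstd : IsStd T.1 := T.2
  obtain ⟨o, ho⟩ := exists_entry T.1 (cell_mem_of_le T.1 a (Nat.zero_le _) (Nat.zero_le _))
  have hoa : o < a := hstd.2 o a (by simp [ho, ha]) (by simp [ho, ha])
  have ho0 : (o : ℕ) = 0 := by
    have := hstd.le_of_le (a := o) (b := ⟨0, by omega⟩) (by simp [ho]) (by simp [ho])
    simpa using Fin.le_def.1 this
  have hoa' := Fin.lt_def.1 hoa
  let m : Fin (n - 1) := ⟨a - 1, by omega⟩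
  have hm : (m : ℕ) + 1 = a := by simp only [m]; omega
  have hR : adjRight m = a := Fin.ext hm
  have hLa : ((adjLeft m : Fin n) : ℕ) + 1 = a := hm
  -- The predecessor of `a` lies in the first row.
  have hrow : (T.1 (adjLeft m)).1.1 = 0 := by
    by_contra hne
    have := Fin.le_def.1 (hstd.le_of_le (a := a) (b := adjLeft m)
      (by rw [ha]; exact Nat.one_le_iff_ne_zero.2 hne) (by simp [ha]))
    omega
  have hax : axial T.1 m = -1 - ((T.1 (adjLeft m)).1.2 : ℤ) := by
    simp [axial, cont, hR, ha, hrow]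
  have hr : axial T.1 m ≠ 1 := by omega
  -- The coordinate at `T` of the equation `v A = v` for the matrix `A` of the transposition.
  have hself : v T = v T * (1 / (axial T.1 m : ℂ)) +
      offCoeff (axial T.1 m) * (v ⬝ᵥ fillVec (swapF m T.1)) := by
    have h1 := congrArg (fun w => w ⬝ᵥ fillVec T.1) (hv m (by omega))
    simp only [← Matrix.dotProduct_mulVec, adjMatrix_mulVec, dotProduct_add, dotProduct_smul,
      smul_eq_mul] at h1
    rw [fillVec_std, dotProduct_single_one] at h1
    linear_combination -h1
  have hsw : offCoeff (axial T.1 m) * (v ⬝ᵥ fillVec (swapF m T.1)) = 0 := by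
    by_cases hj : (T.1 (adjLeft m)).1.2 = 0
    · rw [offCoeff_of_sq_eq_one (Or.inr (by rw [hax, hj]; rfl)), zero_mul]
    · have hs : IsStd (swapF m T.1) :=
        hstd.swapF (by rw [hR, ha, hrow]; simp) (by rw [hR, ha]; exact hj)
      have h0 := ih (k - 1) (by omega) hs.tableau (adjLeft m)
        (by
          change (T.1 (adjSwap m (adjLeft m))).1 = _
          rw [adjSwap_left, hR, ha]) (by omega) (by omega)
      have : fillVec (swapF m T.1) = Pi.single hs.tableau 1 := fillVec_std hs.tableau
      rw [this, dotProduct_single_one, h0, mul_zero]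
  rw [hsw, add_zero] at hself
  have hne : (1 : ℂ) - 1 / (axial T.1 m : ℂ) ≠ 0 := by
    intro e
    have h2 : (axial T.1 m : ℂ) = 1 := by
      have : (1 : ℂ) / (axial T.1 m : ℂ) = 1 := (sub_eq_zero.1 e).symm
      exact (eq_of_div_eq_one this).symm
    exact hr (by exact_mod_cast h2)
  have : v T * (1 - 1 / (axial T.1 m : ℂ)) = 0 := by linear_combination hself
  exact (mul_eq_zero.1 this).resolve_right hne

theorem tau_apply_of_not_admissible (T' : StdTableau n μ) {T : StdTableau n μ}
    (hT : ¬ Admissible T) : tau n μ T' T = 0 := by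
  refine eq_zero_of_not_admissible (v := (tau n μ) T') (fun m hm => ?_) T hT
  have := tau_mul_yor (μ := μ) (adjSwap_mem_subSym hm)
  rw [yor_adjSwap] at this
  exact congrFun this T'

theorem mul_tau_apply_of_not_admissible (A : Matrix (StdTableau n μ) (StdTableau n μ) ℂ)
    (T' : StdTableau n μ) {T : StdTableau n μ} (hT : ¬ Admissible T) :
    (A * tau n μ) T' T = 0 := by
  rw [Matrix.mul_apply]
  exact Finset.sum_eq_zero fun x _ => by rw [tau_apply_of_not_admissible x hT, mul_zero]

theorem tau_mul_apply_of_not_admissible (A : Matrix (StdTableau n μ) (StdTableau n μ) ℂ)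
    {T' : StdTableau n μ} (T : StdTableau n μ) (hT : ¬ Admissible T') :
    (tau n μ * A) T' T = 0 := by
  have := mul_tau_apply_of_not_admissible Aᴴ T hT
  rw [← tau_conjTranspose, ← Matrix.conjTranspose_mul, Matrix.conjTranspose_apply] at this
  simpa using this

open Classical in
theorem fourier_mul_tau {F : Equiv.Perm (Fin n) → ℂ}
    (hF : ∀ g, ∀ h ∈ subSym n, F (g * h) = F g) : fourier F μ * tau n μ = fourier F μ := by
  have key : ∀ h : subSym n, ∑ g, F g • (yor μ g * yor μ (h : Equiv.Perm (Fin n)))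
      = ∑ g, F g • yor μ g := by
    intro h
    refine Fintype.sum_equiv (Equiv.mulRight (h : Equiv.Perm (Fin n))) _ _ fun g => ?_
    rw [← yor_mul]
    simp only [Equiv.coe_mulRight]
    rw [hF g h h.2]
  unfold fourier tau
  rw [Matrix.smul_mul, Matrix.mul_smul, Finset.mul_sum]
  congr 1
  simp only [Finset.sum_mul, Matrix.smul_mul, key]
  rw [Finset.sum_const, Finset.card_univ, ← Nat.cast_smul_eq_nsmul ℂ, smul_smul,
    one_div_mul_cancel, one_smul]
  exact Nat.cast_ne_zero.2 Fintype.card_ne_zero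

theorem comp_mul_subSym {d : ℕ} (f : Coset n → Fin d → ℂ) (i : Fin d) (g : Equiv.Perm (Fin n))
    {h : Equiv.Perm (Fin n)} (hh : h ∈ subSym n) : comp f i (g * h) = comp f i g := by
  unfold comp
  rw [QuotientGroup.mk_mul_of_mem g hh]

/-- A block of the reduced spectrum, with the projection `τ` on both sides. -/
theorem sHat_conjTranspose_mul_fourier {d m : ℕ} (f : Coset n → Fin d → ℂ)
    (I : Fin (m + 2) → Fin d) (G : Fin m → Equiv.Perm (Fin n)) (i : Fin d) :
    (sHat f I G μ)ᴴ * fourier (comp f i) μ =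
      tau n μ * ((rHat f I G μ)ᴴ * fourier (comp f i) μ) * tau n μ := by
  rw [sHat, Matrix.conjTranspose_mul, tau_conjTranspose, Matrix.mul_assoc (tau n μ),
    Matrix.mul_assoc, Matrix.mul_assoc,
    fourier_mul_tau fun g h hh => comp_mul_subSym f i g hh]

end Tau

/-! ### Admissible tableaux and the positions of non-zero entries -/

section Positions

variable {n : ℕ} {μ : YoungDiagram}

theorem mem_cells_iff_of_rowLens {L : List ℕ} (h : μ.rowLens = L) {i j : ℕ} :
    (i, j) ∈ μ.cells ↔ ∃ hi : i < L.length, j < L[i] := by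
  subst h
  conv_lhs => rw [← YoungDiagram.ofRowLens_to_rowLens_eq_self (μ := μ)]
  exact YoungDiagram.mem_ofRowLens

theorem youngDiagram_eq_of_rowLens {ν : YoungDiagram} (h : μ.rowLens = ν.rowLens) : μ = ν := by
  refine YoungDiagram.ext (Finset.ext fun c => ?_)
  obtain ⟨i, j⟩ := c
  rw [mem_cells_iff_of_rowLens h, mem_cells_iff_of_rowLens rfl]

/-- A standard tableau is determined by its entries outside the first row. -/
theorem tableau_eq_of_eq_below {T T' : StdTableau n μ}
    (h : ∀ a, 1 ≤ (T.1 a).1.1 → T.1 a = T'.1 a) : T = T' := by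
  have hrow : ∀ a, (T.1 a).1.1 = 0 ↔ (T'.1 a).1.1 = 0 := by
    intro a
    constructor
    · intro ha
      by_contra hne
      have h1 := h (T.1.symm (T'.1 a)) (by simp; omega)
      rw [Equiv.apply_symm_apply] at h1
      have h2 : T.1 a = T'.1 a :=
        (congrArg T.1 (T'.1.injective h1.symm)).symm.trans (Equiv.apply_symm_apply _ _)
      exact hne (h2 ▸ ha)
    · intro ha
      by_contra hne
      rw [← h a (by omega)] at ha
      exact hne ha
  -- The first rows are increasing enumerations of the same set of letters.
  have hmem : ∀ j : Fin (μ.rowLen 0), (0, (j : ℕ)) ∈ μ.cells := fun j =>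
    (μ.mem_cells _).2 (YoungDiagram.mem_iff_lt_rowLen.2 j.2)
  have hmono : ∀ S : StdTableau n μ, StrictMono fun j => S.1.symm ⟨_, hmem j⟩ := by
    intro S i j hij
    exact S.2.1 _ _ (by simp) (by simpa using hij)
  have hrange : ∀ S : StdTableau n μ,
      Set.range (fun j => S.1.symm ⟨_, hmem j⟩) = {a | (S.1 a).1.1 = 0} := by
    intro S
    ext a
    constructor
    · rintro ⟨j, rfl⟩
      simp
    · intro ha
      have ha : (S.1 a).1.1 = 0 := ha
      have hlt : (S.1 a).1.2 < μ.rowLen 0 := by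
        rw [← YoungDiagram.mem_iff_lt_rowLen, ← ha]
        exact (μ.mem_cells _).1 (S.1 a).2
      refine ⟨⟨_, hlt⟩, ?_⟩
      rw [Equiv.symm_apply_eq]
      exact Subtype.ext (Prod.ext ha.symm rfl)
  have heq := ((hmono T).range_inj (hmono T')).1
    (by rw [hrange, hrange]; ext a; exact hrow a)
  refine stdTableau_ext_iff.2 (Equiv.ext fun a => ?_)
  rcases Nat.eq_zero_or_pos (T.1 a).1.1 with h0 | h0
  · have hlt : (T.1 a).1.2 < μ.rowLen 0 := by
      rw [← YoungDiagram.mem_iff_lt_rowLen, ← h0]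
      exact (μ.mem_cells _).1 (T.1 a).2
    have h1 := congrFun heq ⟨_, hlt⟩
    have h2 : (⟨_, hmem ⟨_, hlt⟩⟩ : {c : ℕ × ℕ // c ∈ μ.cells}) = T.1 a :=
      Subtype.ext (Prod.ext h0.symm rfl)
    simp only [h2, Equiv.symm_apply_apply] at h1
    conv_rhs => rw [h1]
    simp
  · exact h a h0

/-- The last letter lies in the cell `(1, 0)`. -/
def LastBelow (hn : 4 ≤ n) (T : StdTableau n μ) : Prop :=
  (T.1 (letter hn 0)).1 = (1, 0)

/-- In a shape with two cells below the first row, an admissible tableau has the last two letters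
there. -/
theorem admissible_entries (hn : 4 ≤ n) {T : StdTableau n μ} (hT : Admissible T) {i j : ℕ}
    (hij : (i, j) = (1, 1) ∨ (i, j) = (2, 0)) (hmem : (i, j) ∈ μ.cells) :
    (T.1 (letter hn 1)).1 = (1, 0) ∧ (T.1 (letter hn 0)).1 = (i, j) := by
  obtain ⟨b, hb⟩ := exists_entry T.1 hmem
  have h10 : (1, 0) ∈ μ.cells := by
    rcases hij with h | h <;> obtain ⟨rfl, rfl⟩ := Prod.ext_iff.1 h
    · exact cell_mem_of_le T.1 b (by simp [hb]) (by simp [hb])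
    · exact cell_mem_of_le T.1 b (by simp [hb]) (by simp [hb])
  obtain ⟨a, ha⟩ := exists_entry T.1 h10
  have hab : a < b := by
    rcases hij with h | h <;> obtain ⟨rfl, rfl⟩ := Prod.ext_iff.1 h
    · exact T.2.1 a b (by simp [ha, hb]) (by simp [ha, hb])
    · exact T.2.2 a b (by simp [ha, hb]) (by simp [ha, hb])
  have h1 := hT a ha
  have h2 := Fin.lt_def.1 hab
  have ea : letter hn 1 = a := Fin.ext (by simp [letter]; omega)
  have eb : letter hn 0 = b := Fin.ext (by simp [letter]; omega)
  rw [ea, eb]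
  exact ⟨ha, hb⟩

/-- An admissible tableau of a shape in `Λ_n` is determined by whether its last letter lies in the
cell `(1, 0)`. -/
theorem admissible_unique (hn : 4 ≤ n) (hμ : μ ∈ Lam n) {T T' : StdTableau n μ}
    (hT : Admissible T) (hT' : Admissible T') (h : LastBelow hn T ↔ LastBelow hn T') : T = T' := by
  refine tableau_eq_of_eq_below fun a ha => ?_
  have hcell := (T.1 a).2
  rcases hij : (T.1 a).1 with ⟨i, j⟩
  rw [hij] at ha hcell
  refine Subtype.ext ?_
  rw [hij]
  -- The shapes with two cells below the first row: these hold the last two letters, in order.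
  have two : ∀ (i' j' : ℕ), (i', j') = (1, 1) ∨ (i', j') = (2, 0) → (i', j') ∈ μ.cells →
      (i, j) = (1, 0) ∨ (i, j) = (i', j') → (i, j) = (T'.1 a).1 := by
    intro i' j' h' hm hc
    obtain ⟨t1, t2⟩ := admissible_entries hn hT h' hm
    obtain ⟨t1', t2'⟩ := admissible_entries hn hT' h' hm
    rcases hc with hc | hc
    · rw [hc, ← t1] at hij
      rw [T.1.injective (Subtype.ext hij), t1', hc]
    · rw [hc, ← t2] at hij
      rw [T.1.injective (Subtype.ext hij), t2', hc]
  rcases hμ with hμ | hμ | hμ | hμ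
  · obtain ⟨hi, -⟩ := (mem_cells_iff_of_rowLens hμ).1 hcell
    simp at hi ha
    omega
  · obtain ⟨hi, hj⟩ := (mem_cells_iff_of_rowLens hμ).1 hcell
    simp only [List.length_cons, List.length_nil] at hi ha
    obtain rfl : i = 1 := by omega
    obtain rfl : j = 0 := by simpa using hj
    obtain ⟨b, hb⟩ := exists_entry T'.1 hcell
    have h1 := hT a hij
    have h2 := hT' b hb
    have hl : ∀ c : Fin n, n - 2 ≤ (c : ℕ) → c = letter hn 1 ∨ c = letter hn 0 := by
      intro c hc
      rcases Nat.lt_or_ge c (n - 1) with h | h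
      · exact Or.inl (Fin.ext (by simp [letter]; omega))
      · exact Or.inr (Fin.ext (by simp [letter]; omega))
    rcases hl a h1 with rfl | rfl
    · rcases hl b h2 with rfl | rfl
      · exact hb.symm
      · have := h.2 hb
        have := T.1.injective (Subtype.ext (hij.trans this.symm))
        have := congrArg Fin.val this
        simp [letter] at this
        omega
    · exact (h.1 hij).symm
  · refine two 1 1 (Or.inl rfl) ((mem_cells_iff_of_rowLens hμ).2 (by simp)) ?_
    obtain ⟨hi, hj⟩ := (mem_cells_iff_of_rowLens hμ).1 hcell
    simp only [List.length_cons, List.length_nil] at hi ha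
    obtain rfl : i = 1 := by omega
    have hj : j < 2 := by simpa using hj
    rcases (by omega : j = 0 ∨ j = 1) with rfl | rfl <;> simp
  · refine two 2 0 (Or.inr rfl) ((mem_cells_iff_of_rowLens hμ).2 (by simp)) ?_
    obtain ⟨hi, hj⟩ := (mem_cells_iff_of_rowLens hμ).1 hcell
    simp only [List.length_cons, List.length_nil] at hi ha
    rcases (by omega : i = 1 ∨ i = 2) with rfl | rfl
    · obtain rfl : j = 0 := by simpa using hj
      simp
    · obtain rfl : j = 0 := by simpa using hj
      simp

/-- The positions of the doubly-reduced spectrum that may hold a non-zero entry. -/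
def Essential {d m : ℕ} (p : Position n d m) : Prop :=
  p.row.2 = p.col.2 ∧ Admissible p.row.1 ∧ Admissible p.col.1

theorem doublyReducedSpectrum_eq_zero {d m : ℕ} (hn : 4 ≤ n) (f : Coset n → Fin d → ℂ)
    {p : Position n d m} (hp : ¬ Essential p) : doublyReducedSpectrum hn f p = 0 := by
  unfold doublyReducedSpectrum reducedSpectrum
  rw [Matrix.blockDiagonal_apply]
  by_cases h1 : p.row.2 = p.col.2
  · rw [if_pos h1, sHat_conjTranspose_mul_fourier]
    by_cases h2 : Admissible p.row.1
    · exact mul_tau_apply_of_not_admissible _ _ fun h3 => hp ⟨h1, h2, h3⟩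
    · rw [Matrix.mul_assoc]
      exact tau_mul_apply_of_not_admissible _ _ h2
  · rw [if_neg h1]

open Classical in
/-- A number for the shape, the row tableau and the column tableau of an essential position: the
four shapes contribute `1`, `2 * 2`, `1` and `1` possibilities. -/
def shapeCode {d m : ℕ} (hn : 4 ≤ n) (p : Position n d m) : Fin 7 :=
  if p.shape.rowLens = [n] then 0
  else if p.shape.rowLens = [n - 2, 2] then 1
  else if p.shape.rowLens = [n - 2, 1, 1] then 2
  else if LastBelow hn p.row.1 then (if LastBelow hn p.col.1 then 3 else 4)
  else (if LastBelow hn p.col.1 then 5 else 6)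

/-- Only the shape `(n - 1, 1)` admits a choice of the letter in the cell `(1, 0)`. -/
theorem not_lastBelow (hn : 4 ≤ n) (hμ : μ ∈ Lam n) (h : μ.rowLens ≠ [n - 1, 1])
    {T : StdTableau n μ} (hT : Admissible T) : ¬ LastBelow hn T := by
  intro hl
  have hcell := (T.1 (letter hn 0)).2
  rw [show (T.1 (letter hn 0)).1 = (1, 0) from hl] at hcell
  rcases hμ with hμ | hμ | hμ | hμ
  · obtain ⟨hi, -⟩ := (mem_cells_iff_of_rowLens hμ).1 hcell
    simp at hi
  · exact h hμ
  · have := (admissible_entries hn hT (Or.inl rfl)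
      ((mem_cells_iff_of_rowLens hμ (i := 1) (j := 1)).2 (by simp))).2
    rw [show (T.1 (letter hn 0)).1 = (1, 0) from hl] at this
    simp at this
  · have := (admissible_entries hn hT (Or.inr rfl)
      ((mem_cells_iff_of_rowLens hμ (i := 2) (j := 0)).2 (by simp))).2
    rw [show (T.1 (letter hn 0)).1 = (1, 0) from hl] at this
    simp at this

theorem essential_ext {d m : ℕ} (hn : 4 ≤ n) {p q : Position n d m} (hp : Essential p)
    (hq : Essential q) (he : p.elems = q.elems) (hI : p.row.2 = q.row.2)
    (hc : shapeCode hn p = shapeCode hn q) : p = q := by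
  have hshape : p.shape.rowLens = q.shape.rowLens := by
    have hp' := p.shape_mem
    have hq' := q.shape_mem
    simp only [Lam, Set.mem_ofPred_eq] at hp' hq'
    unfold shapeCode at hc
    split_ifs at hc <;> simp_all
  have hlast : (LastBelow hn p.row.1 ↔ LastBelow hn q.row.1) ∧
      (LastBelow hn p.col.1 ↔ LastBelow hn q.col.1) := by
    by_cases h : p.shape.rowLens = [n - 1, 1]
    · have h' := hshape ▸ h
      have ne : [n - 1, 1] ≠ [n - 2, 2] := by simp
      unfold shapeCode at hc
      rw [h, h'] at hc
      simp only [List.cons.injEq, reduceCtorEq, and_false, if_false, OfNat.one_ne_ofNat,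
        and_true] at hc
      split_ifs at hc <;> simp_all
    · have h' := hshape ▸ h
      exact ⟨iff_of_false (not_lastBelow hn p.shape_mem h hp.2.1)
        (not_lastBelow hn q.shape_mem h' hq.2.1),
        iff_of_false (not_lastBelow hn p.shape_mem h hp.2.2)
        (not_lastBelow hn q.shape_mem h' hq.2.2)⟩
  obtain ⟨s, hs, e, ⟨r, I⟩, ⟨c, J⟩⟩ := p
  obtain ⟨s', hs', e', ⟨r', I'⟩, ⟨c', J'⟩⟩ := q
  obtain ⟨hp0, p1, p2⟩ := hp
  obtain ⟨hq0, q1, q2⟩ := hq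
  dsimp only at *
  obtain rfl := youngDiagram_eq_of_rowLens hshape
  subst hp0 hq0
  obtain rfl : e = e' := he
  obtain rfl : I = I' := hI
  obtain rfl : r = r' := admissible_unique hn hs p1 q1 hlast.1
  obtain rfl : c = c' := admissible_unique hn hs p2 q2 hlast.2
  rfl

theorem encard_essential_le (hn : 4 ≤ n) (d m : ℕ) :
    {p : Position n d m | Essential p}.encard ≤
      ((Nat.choose 7 m * 7 * d ^ (m + 2) : ℕ) : ℕ∞) := by
  classical
  let S : Finset (Finset (Fin 7) × (Fin (m + 2) → Fin d) × Fin 7) :=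
    Finset.powersetCard m Finset.univ ×ˢ Finset.univ ×ˢ Finset.univ
  have hS : S.card = Nat.choose 7 m * 7 * d ^ (m + 2) := by
    simp [S, Finset.card_product, Finset.card_powersetCard, mul_assoc, mul_comm]
  rw [← hS, ← Set.encard_coe_eq_coe_finsetCard]
  refine Set.encard_le_encard_of_injOn
    (f := fun p => (Finset.univ.map p.elems.toEmbedding, p.row.2, shapeCode hn p)) ?_ ?_
  · intro p _
    simp [S, Finset.mem_powersetCard]
  · intro p hp q hq hpq
    simp only [Prod.mk.injEq] at hpq
    refine essential_ext hn hp hq ?_ hpq.2.1 hpq.2.2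
    refine DFunLike.coe_injective ((p.elems.strictMono.range_inj q.elems.strictMono).1 ?_)
    have := congrArg (fun s : Finset (Fin 7) => (s : Set (Fin 7))) hpq.1
    simpa using this

end Positions

/-! ### Double cosets of `S_{n-2}` and sums over the group -/

section Group

variable {n : ℕ}

theorem letter_injective (hn : 4 ≤ n) : Function.Injective (letter hn) := by
  intro i j e
  have := congrArg Fin.val e
  simp only [letter] at this
  exact Fin.ext (by omega)

theorem mem_subSym_iff (hn : 4 ≤ n) {g : Equiv.Perm (Fin n)} :
    g ∈ subSym n ↔ g (letter hn 1) = letter hn 1 ∧ g (letter hn 0) = letter hn 0 := by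
  rw [mem_subSym]
  constructor
  · intro h
    exact ⟨h _ (by simp [letter]; omega), h _ (by simp [letter]; omega)⟩
  · rintro ⟨h1, h0⟩ x hx
    rcases Nat.lt_or_ge x (n - 1) with h | h
    · rwa [show x = letter hn 1 from Fin.ext (by simp [letter]; omega)]
    · rwa [show x = letter hn 0 from Fin.ext (by simp [letter]; omega)]

theorem exists_perm_letter (hn : 4 ≤ n) {a b c e : Fin n} (hab : a ≠ b) (hac : a ≠ c)
    (hae : a ≠ e) (hbc : b ≠ c) (hbe : b ≠ e) (hce : c ≠ e) :
    ∃ g : Equiv.Perm (Fin n), g (letter hn 0) = a ∧ g (letter hn 1) = b ∧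
      g (letter hn 2) = c ∧ g (letter hn 3) = e := by
  have hinj : Function.Injective ![a, b, c, e] := by
    intro i j h
    fin_cases i <;> fin_cases j <;> simp_all [Ne.symm]
  have := Equiv.Perm.isMultiplyPretransitive (Fin n) 4
  obtain ⟨g, hg⟩ := this.exists_smul_eq ⟨letter hn, letter_injective hn⟩ ⟨_, hinj⟩
  have h : ∀ i, g (letter hn i) = ![a, b, c, e] i := fun i => DFunLike.congr_fun hg i
  exact ⟨g, h 0, h 1, h 2, h 3⟩

theorem exists_notMem_of_card_lt (s : Finset (Fin n)) (h : s.card < n) : ∃ c, c ∉ s := by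
  by_contra! hc
  have : s = Finset.univ := Finset.eq_univ_of_forall hc
  rw [this, Finset.card_univ, Fintype.card_fin] at h
  exact lt_irrefl _ h

theorem exists_perm_two (hn : 4 ≤ n) {a b : Fin n} (hab : a ≠ b) :
    ∃ g : Equiv.Perm (Fin n), g (letter hn 1) = a ∧ g (letter hn 0) = b := by
  obtain ⟨c, hc⟩ := exists_notMem_of_card_lt {a, b}
    (by have := Finset.card_le_two (a := a) (b := b); omega)
  obtain ⟨e, he⟩ := exists_notMem_of_card_lt {a, b, c}
    (by have := Finset.card_le_three (a := a) (b := b) (c := c); omega)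
  simp only [Finset.mem_insert, Finset.mem_singleton, not_or] at hc he
  obtain ⟨g, h0, h1, -, -⟩ := exists_perm_letter hn hab.symm (Ne.symm hc.2) (Ne.symm he.2.1)
    (Ne.symm hc.1) (Ne.symm he.1) (Ne.symm he.2.2)
  exact ⟨g, h1, h0⟩

theorem exists_subSym_apply (hn : 4 ≤ n) {p q : Fin n} (hp0 : p ≠ letter hn 0)
    (hp1 : p ≠ letter hn 1) (hq0 : q ≠ letter hn 0) (hq1 : q ≠ letter hn 1) (hpq : p ≠ q) :
    ∃ h ∈ subSym n, h (letter hn 2) = p ∧ h (letter hn 3) = q := by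
  have h01 : letter hn 0 ≠ letter hn 1 := (letter_injective hn).ne (by decide)
  obtain ⟨g, g0, g1, g2, g3⟩ :=
    exists_perm_letter hn h01 hp0.symm hq0.symm hp1.symm hq1.symm hpq
  exact ⟨g, (mem_subSym_iff hn).2 ⟨g1, g0⟩, g2, g3⟩

theorem exists_subSym_apply_one (hn : 4 ≤ n) {p : Fin n} (hp0 : p ≠ letter hn 0)
    (hp1 : p ≠ letter hn 1) : ∃ h ∈ subSym n, h (letter hn 2) = p := by
  obtain ⟨q, hq⟩ := exists_notMem_of_card_lt {letter hn 0, letter hn 1, p}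
    (by have := Finset.card_le_three (a := letter hn 0) (b := letter hn 1) (c := p); omega)
  simp only [Finset.mem_insert, Finset.mem_singleton, not_or] at hq
  obtain ⟨h, hh, h2, -⟩ := exists_subSym_apply hn hp0 hp1 hq.1 hq.2.1 (Ne.symm hq.2.2)
  exact ⟨h, hh, h2⟩

/-- The images of the letters `n - 1` and `n` under `g * doubleCosetRep hn D`, in terms of
`x = g (n - 1)`, `y = g n`, `p = g (n - 2)`, `q = g (n - 3)`. -/
def repPair {X : Type*} (x y p q : X) : Fin 7 → X × X :=
  ![(x, y), (y, x), (p, y), (x, p), (y, p), (p, x), (q, p)]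

theorem doubleCosetRep_apply (hn : 4 ≤ n) (g : Equiv.Perm (Fin n)) (D : Fin 7) :
    ((g * doubleCosetRep hn D) (letter hn 1), (g * doubleCosetRep hn D) (letter hn 0)) =
      repPair (g (letter hn 1)) (g (letter hn 0)) (g (letter hn 2)) (g (letter hn 3)) D := by
  fin_cases D <;>
    simp [doubleCosetRep, repPair, Equiv.swap_apply_def, (letter_injective hn).eq_iff]

/-- Every permutation lies in one of the seven double cosets of `S_{n-2}`. -/
theorem exists_doubleCosetRep (hn : 4 ≤ n) (w : Equiv.Perm (Fin n)) :
    ∃ D, ∃ h ∈ subSym n, ∃ h' ∈ subSym n, w = h * doubleCosetRep hn D * h' := by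
  suffices H : ∃ D, ∃ h ∈ subSym n,
      repPair (h (letter hn 1)) (h (letter hn 0)) (h (letter hn 2)) (h (letter hn 3)) D =
        (w (letter hn 1), w (letter hn 0)) by
    obtain ⟨D, h, hh, e⟩ := H
    rw [← doubleCosetRep_apply] at e
    refine ⟨D, h, hh, (h * doubleCosetRep hn D)⁻¹ * w, ?_, by group⟩
    rw [mem_subSym_iff hn]
    simp only [Equiv.Perm.mul_apply, Prod.mk.injEq] at e ⊢
    rw [← e.1, ← e.2]
    simp
  have hne : w (letter hn 1) ≠ w (letter hn 0) :=
    w.injective.ne ((letter_injective hn).ne (by decide))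
  have fix : ∀ h ∈ subSym n, h (letter hn 1) = letter hn 1 ∧ h (letter hn 0) = letter hn 0 :=
    fun h hh => (mem_subSym_iff hn).1 hh
  generalize w (letter hn 1) = a at *
  generalize w (letter hn 0) = b at *
  by_cases a1 : a = letter hn 1
  · by_cases b0 : b = letter hn 0
    · exact ⟨0, 1, one_mem _, by simp [repPair, a1, b0]⟩
    · obtain ⟨h, hh, h2⟩ := exists_subSym_apply_one hn b0 (a1 ▸ hne.symm)
      exact ⟨3, h, hh, by simp [repPair, fix h hh, h2, a1]⟩
  by_cases a0 : a = letter hn 0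
  · by_cases b1 : b = letter hn 1
    · exact ⟨1, 1, one_mem _, by simp [repPair, a0, b1]⟩
    · obtain ⟨h, hh, h2⟩ := exists_subSym_apply_one hn (a0 ▸ hne.symm) b1
      exact ⟨4, h, hh, by simp [repPair, fix h hh, h2, a0]⟩
  by_cases b0 : b = letter hn 0
  · obtain ⟨h, hh, h2⟩ := exists_subSym_apply_one hn a0 a1
    exact ⟨2, h, hh, by simp [repPair, fix h hh, h2, b0]⟩
  by_cases b1 : b = letter hn 1
  · obtain ⟨h, hh, h2⟩ := exists_subSym_apply_one hn a0 a1
    exact ⟨5, h, hh, by simp [repPair, fix h hh, h2, b1]⟩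
  · obtain ⟨h, hh, h2, h3⟩ := exists_subSym_apply hn b0 b1 a0 a1 hne.symm
    exact ⟨6, h, hh, by simp [repPair, h2, h3]⟩

open Classical in
/-- A sum over a finite group of a function on an orbit is a multiple of the sum over the orbit. -/
theorem exists_sum_smul_eq {K X : Type*} [Group K] [Fintype K] [MulAction K X] [Fintype X]
    (x₀ : X) : ∃ N : ℂ, ∀ φ : X → ℂ, ∑ k : K, φ (k • x₀) =
      N * ∑ x, if x ∈ MulAction.orbit K x₀ then φ x else 0 := by
  refine ⟨Fintype.card (MulAction.stabilizer K x₀), fun φ => ?_⟩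
  rw [← Finset.sum_fiberwise_of_maps_to (g := fun k : K => k • x₀) (t := Finset.univ)
    (fun _ _ => Finset.mem_univ _), Finset.mul_sum]
  refine Finset.sum_congr rfl fun x _ => ?_
  have h1 : ∑ k ∈ Finset.univ.filter (fun k : K => k • x₀ = x), φ (k • x₀) =
      ((Finset.univ.filter (fun k : K => k • x₀ = x)).card : ℂ) * φ x := by
    rw [Finset.sum_congr rfl (g := fun _ => φ x)
      (fun k hk => by rw [(Finset.mem_filter.1 hk).2]), Finset.sum_const, nsmul_eq_mul]
  rw [h1]
  by_cases hx : x ∈ MulAction.orbit K x₀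
  · rw [if_pos hx]
    obtain ⟨k₀, rfl⟩ := hx
    congr 2
    rw [Fintype.card_subtype]
    refine Finset.card_bij (fun k _ => k₀⁻¹ * k) ?_ ?_ ?_
    · intro k hk
      simp only [Finset.mem_filter, Finset.mem_univ, true_and, MulAction.mem_stabilizer_iff] at hk ⊢
      rw [mul_smul, hk, inv_smul_smul]
    · intro k _ k' _ e
      exact mul_left_cancel e
    · intro k hk
      simp only [Finset.mem_filter, Finset.mem_univ, true_and, MulAction.mem_stabilizer_iff] at hk
      exact ⟨k₀ * k, by simp [mul_smul, hk], by simp⟩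
  · rw [if_neg hx, mul_zero, Finset.filter_false_of_mem, Finset.card_empty, Nat.cast_zero, zero_mul]
    rintro k - rfl
    exact hx ⟨k, rfl⟩

/-- Sums over `S_n` of functions of the images of the last two letters. -/
theorem exists_sum_perm_eq (hn : 4 ≤ n) : ∃ N : ℂ, ∀ φ : Fin n → Fin n → ℂ, (∀ x, φ x x = 0) →
    ∑ g : Equiv.Perm (Fin n), φ (g (letter hn 1)) (g (letter hn 0)) = N * ∑ x, ∑ y, φ x y := by
  classical
  obtain ⟨N, hN⟩ := exists_sum_smul_eq (K := Equiv.Perm (Fin n)) (letter hn 1, letter hn 0)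
  refine ⟨N, fun φ hφ => (hN fun z : Fin n × Fin n => φ z.1 z.2).trans ?_⟩
  rw [Fintype.sum_prod_type]
  congr 1
  refine Finset.sum_congr rfl fun x _ => Finset.sum_congr rfl fun y _ => ?_
  by_cases hxy : x = y
  · subst hxy
    simp [hφ]
  · rw [if_pos]
    obtain ⟨g, h1, h0⟩ := exists_perm_two hn hxy
    exact ⟨g, Prod.ext h1 h0⟩

open Classical in
/-- Sums over a coset of `S_{n-2}` of functions of the images of the letters `n - 2`, `n - 3`. -/
theorem exists_sum_subSym_eq (hn : 4 ≤ n) : ∃ N : ℂ, ∀ (g : Equiv.Perm (Fin n))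
    (φ : Fin n → Fin n → ℂ), (∀ x, φ x x = 0) →
    (∀ x, φ (g (letter hn 0)) x = 0) → (∀ x, φ (g (letter hn 1)) x = 0) →
    ∑ h : subSym n, φ ((g * h) (letter hn 2)) ((g * h) (letter hn 3)) =
      N * ∑ p, ∑ q, if q = g (letter hn 1) ∨ q = g (letter hn 0) then 0 else φ p q := by
  obtain ⟨N, hN⟩ := exists_sum_smul_eq (K := subSym n) (letter hn 2, letter hn 3)
  refine ⟨N, fun g φ hφ h0 h1 => (hN fun z : Fin n × Fin n => φ (g z.1) (g z.2)).trans ?_⟩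
  rw [Fintype.sum_prod_type]
  congr 1
  refine Fintype.sum_equiv g _ _ fun p => Fintype.sum_equiv g _ _ fun q => ?_
  have ne : ∀ i j, i ≠ j → letter hn i ≠ letter hn j := fun i j h => (letter_injective hn).ne h
  simp only [g.injective.eq_iff]
  by_cases hq : q = letter hn 1 ∨ q = letter hn 0
  · rw [if_pos hq, if_neg]
    rintro ⟨h, e⟩
    have e : h.1 (letter hn 3) = q := congrArg Prod.snd e
    obtain ⟨f1, f0⟩ := (mem_subSym_iff hn).1 h.2
    rcases hq with rfl | rfl
    · exact ne 3 1 (by decide) (h.1.injective (e.trans f1.symm))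
    · exact ne 3 0 (by decide) (h.1.injective (e.trans f0.symm))
  · rw [if_neg hq]
    by_cases hp : p = letter hn 0 ∨ p = letter hn 1 ∨ p = q
    · have : φ (g p) (g q) = 0 := by
        rcases hp with rfl | rfl | rfl
        exacts [h0 _, h1 _, hφ _]
      rw [this, ite_self]
    · push Not at hp hq
      rw [if_pos]
      obtain ⟨h, hh, h2, h3⟩ := exists_subSym_apply hn hp.1 hp.2.1 hq.2 hq.1 hp.2.2
      exact ⟨⟨h, hh⟩, Prod.ext h2 h3⟩

end Group

/-! ### The entries of the spectrum as sums over pairs of letters -/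

section Entries

variable {n d : ℕ}

open Classical in
/-- The coset of the permutations that map the letters `n - 1` and `n` to `a` and `b`. (For `a = b`
there are none, and the value is irrelevant.) -/
def pairCoset (hn : 4 ≤ n) (a b : Fin n) : Coset n :=
  if h : ∃ g : Equiv.Perm (Fin n), g (letter hn 1) = a ∧ g (letter hn 0) = b
  then QuotientGroup.mk h.choose else QuotientGroup.mk 1

theorem pairCoset_apply (hn : 4 ≤ n) (g : Equiv.Perm (Fin n)) :
    pairCoset hn (g (letter hn 1)) (g (letter hn 0)) = QuotientGroup.mk g := by
  have h : ∃ g' : Equiv.Perm (Fin n), g' (letter hn 1) = g (letter hn 1) ∧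
      g' (letter hn 0) = g (letter hn 0) := ⟨g, rfl, rfl⟩
  rw [pairCoset, dif_pos h, QuotientGroup.eq, mem_subSym_iff hn]
  have := h.choose_spec
  generalize h.choose = k at *
  exact ⟨Equiv.Perm.inv_eq_iff_eq.2 this.1.symm, Equiv.Perm.inv_eq_iff_eq.2 this.2.symm⟩

/-- A component of `f` as a function on pairs of distinct letters, extended by zero to the diagonal;
`none` stands for the constant function `1` on `S_n`. -/
def pairVal (hn : 4 ≤ n) (f : Coset n → Fin d → ℂ) (o : Option (Fin d)) (a b : Fin n) : ℂ :=
  if a = b then 0 else o.elim 1 fun i => f (pairCoset hn a b) i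

/-- A component of `f` as a function on `S_n`; `none` stands for the constant function `1`. -/
def optComp (f : Coset n → Fin d → ℂ) (o : Option (Fin d)) (g : Equiv.Perm (Fin n)) : ℂ :=
  o.elim 1 fun i => comp f i g

theorem pairVal_self (hn : 4 ≤ n) (f : Coset n → Fin d → ℂ) (o : Option (Fin d)) (a : Fin n) :
    pairVal hn f o a a = 0 := if_pos rfl

theorem optComp_eq (hn : 4 ≤ n) (f : Coset n → Fin d → ℂ) (o : Option (Fin d))
    (g : Equiv.Perm (Fin n)) :
    optComp f o g = pairVal hn f o (g (letter hn 1)) (g (letter hn 0)) := by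
  rw [pairVal, if_neg (g.injective.ne ((letter_injective hn).ne (by decide))), pairCoset_apply]
  rfl

open Classical in
/-- The sum over the coset `g S_{n-2}` of a product of translates of components of `f`, one for each
double coset representative. -/
def cosetSum (hn : 4 ≤ n) (f : Coset n → Fin d → ℂ) (J : Fin 7 → Option (Fin d))
    (g : Equiv.Perm (Fin n)) : ℂ :=
  ∑ h : subSym n, ∏ D, optComp f (J D) (g * h * doubleCosetRep hn D)

/-- The sum of the values at the pairs with second letter `p`. -/
def rowSum (hn : 4 ≤ n) (f : Coset n → Fin d → ℂ) (o : Option (Fin d)) (p : Fin n) : ℂ :=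
  ∑ q, pairVal hn f o q p

/-- A summand of `pairSum`. -/
def pairTerm (hn : 4 ≤ n) (f : Coset n → Fin d → ℂ) (J : Fin 7 → Option (Fin d))
    (x y p : Fin n) : ℂ :=
  pairVal hn f (J 2) p y * pairVal hn f (J 3) x p *
    (pairVal hn f (J 4) y p * pairVal hn f (J 5) p x) *
    (rowSum hn f (J 6) p - pairVal hn f (J 6) x p - pairVal hn f (J 6) y p)

/-- `cosetSum`, up to a constant, as a function of the images `x` and `y` of the last two letters.
Only the last of the seven representatives involves two more letters `p` and `q`; the sum over `q`
is a row sum without two of its terms, so that a single sum over `p` remains. -/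
def pairSum (hn : 4 ≤ n) (f : Coset n → Fin d → ℂ) (J : Fin 7 → Option (Fin d))
    (x y : Fin n) : ℂ :=
  pairVal hn f (J 0) x y * pairVal hn f (J 1) y x * ∑ p, pairTerm hn f J x y p

theorem sum_ite_or_eq {x y : Fin n} (hxy : x ≠ y) (a : Fin n → ℂ) :
    ∑ q, (if q = x ∨ q = y then 0 else a q) = ∑ q, a q - a x - a y := by
  have h : ∀ q, (if q = x ∨ q = y then 0 else a q) =
      a q - (if q = x then a q else 0) - (if q = y then a q else 0) := by
    intro q
    by_cases h1 : q = x
    · subst h1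
      simp [hxy]
    · simp only [h1, false_or, if_false, sub_zero]
      split_ifs <;> simp
  simp only [h, Finset.sum_sub_distrib, Finset.sum_ite_eq', Finset.mem_univ, if_true]

open Classical in
/-- `cosetSum` is a constant multiple of `pairSum`: the condition that `p` differ from `x` and `y`
is enforced by the vanishing of `pairVal` on the diagonal, and so is the condition `q ≠ p`. -/
theorem exists_cosetSum_eq (hn : 4 ≤ n) : ∃ N : ℂ, ∀ {d : ℕ} (f : Coset n → Fin d → ℂ)
    (J : Fin 7 → Option (Fin d)) (g : Equiv.Perm (Fin n)),
    cosetSum hn f J g = N * pairSum hn f J (g (letter hn 1)) (g (letter hn 0)) := by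
  obtain ⟨N, hN⟩ := exists_sum_subSym_eq hn
  refine ⟨N, fun {d} f J g => ?_⟩
  have hxy : g (letter hn 1) ≠ g (letter hn 0) :=
    g.injective.ne ((letter_injective hn).ne (by decide))
  let φ : Fin n → Fin n → ℂ := fun p q => ∏ D, pairVal hn f (J D)
    (repPair (g (letter hn 1)) (g (letter hn 0)) p q D).1
    (repPair (g (letter hn 1)) (g (letter hn 0)) p q D).2
  have hφ : ∀ p q D, pairVal hn f (J D)
      (repPair (g (letter hn 1)) (g (letter hn 0)) p q D).1
      (repPair (g (letter hn 1)) (g (letter hn 0)) p q D).2 = 0 → φ p q = 0 :=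
    fun p q D h => Finset.prod_eq_zero (Finset.mem_univ D) h
  have h1 := hN g φ (fun p => hφ p p 6 (pairVal_self _ _ _ _))
    (fun p => hφ _ p 2 (pairVal_self _ _ _ _)) (fun p => hφ _ p 3 (pairVal_self _ _ _ _))
  have h2 : cosetSum hn f J g =
      ∑ h : subSym n, φ ((g * h) (letter hn 2)) ((g * h) (letter hn 3)) := by
    refine Finset.sum_congr rfl fun h _ => Finset.prod_congr rfl fun D _ => ?_
    obtain ⟨e1, e0⟩ := (mem_subSym_iff hn).1 h.2
    have := doubleCosetRep_apply hn (g * h) D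
    simp only [Prod.ext_iff] at this
    rw [optComp_eq hn, this.1, this.2]
    simp only [Equiv.Perm.mul_apply, e1, e0]
  rw [h2, h1]
  congr 1
  rw [pairSum, Finset.mul_sum]
  refine Finset.sum_congr rfl fun p _ => ?_
  rw [sum_ite_or_eq hxy]
  simp only [φ, Fin.prod_univ_seven, pairTerm, rowSum, repPair, Matrix.cons_val]
  rw [← Finset.mul_sum]
  ring

/-- The assignment of the component `i` to the representative `D`, and of no component to the
others. -/
def singleIdx (D : Fin 7) (i : Fin d) : Fin 7 → Option (Fin d) :=
  fun D' => if D' = D then some i else none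

open Classical in
/-- The assignment of the component `I l` to the representative `e l`, for all `l`. -/
def embIdx {m : ℕ} (e : Fin m ↪o Fin 7) (I : Fin (m + 1) → Fin d) : Fin 7 → Option (Fin d) :=
  fun D => if h : ∃ l, e l = D then some (I h.choose.castSucc) else none

theorem embIdx_apply {m : ℕ} (e : Fin m ↪o Fin 7) (I : Fin (m + 1) → Fin d) (l : Fin m) :
    embIdx e I (e l) = some (I l.castSucc) := by
  have h : ∃ l', e l' = e l := ⟨l, rfl⟩
  rw [embIdx, dif_pos h, e.injective h.choose_spec]

open Classical in
theorem cosetSum_singleIdx (hn : 4 ≤ n) (f : Coset n → Fin d → ℂ) (D : Fin 7) (i : Fin d)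
    (g : Equiv.Perm (Fin n)) : cosetSum hn f (singleIdx D i) g =
      ∑ h : subSym n, comp f i (g * h * doubleCosetRep hn D) := by
  refine Finset.sum_congr rfl fun h _ => ?_
  rw [Finset.prod_eq_single D]
  · simp [singleIdx, optComp]
  · intro D' _ hD
    simp [singleIdx, hD, optComp]
  · simp

open Classical in
theorem cosetSum_embIdx (hn : 4 ≤ n) (f : Coset n → Fin d → ℂ) {m : ℕ} (e : Fin m ↪o Fin 7)
    (I : Fin (m + 1) → Fin d) (g : Equiv.Perm (Fin n)) : cosetSum hn f (embIdx e I) g =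
      ∑ h : subSym n, ∏ l, comp f (I l.castSucc) (g * h * doubleCosetRep hn (e l)) := by
  refine Finset.sum_congr rfl fun h _ => ?_
  refine (Fintype.prod_of_injective e e.injective _ _ (fun D hD => ?_) fun l => ?_).symm
  · have hD' : ¬ ∃ l, e l = D := hD
    rw [embIdx, dif_neg hD']
    rfl
  · rw [embIdx_apply]
    rfl

/-- The matrix coefficients of `r̂† f̂` between invariant vectors, as a double sum over the
group. -/
theorem tau_mul_fourier_mul_tau {μ : YoungDiagram} (F F' : Equiv.Perm (Fin n) → ℂ) :
    tau n μ * ((fourier F μ)ᴴ * fourier F' μ) * tau n μ =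
      ((1 / (Fintype.card (Equiv.Perm (Fin n)) : ℂ)) ^ 2) •
        ∑ g, ∑ w, (star (F g) * F' (g * w)) • (tau n μ * yor μ w * tau n μ) := by
  have h : (∑ g, F g • yor μ g)ᴴ * (∑ g, F' g • yor μ g) =
      ∑ g, ∑ w, (star (F g) * F' (g * w)) • yor μ w := by
    rw [Matrix.conjTranspose_sum, Finset.sum_mul]
    refine Finset.sum_congr rfl fun g _ => ?_
    rw [Finset.mul_sum]
    refine (Fintype.sum_equiv (Equiv.mulLeft g) _ _ fun w => ?_).symm
    rw [Matrix.conjTranspose_smul, yor_conjTranspose, Matrix.smul_mul, Matrix.mul_smul, smul_smul,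
      ← yor_mul, Equiv.coe_mulLeft, inv_mul_cancel_left]
  unfold fourier
  simp only [Matrix.conjTranspose_smul, Matrix.smul_mul, Matrix.mul_smul, h, smul_smul]
  rw [Finset.mul_sum, Finset.sum_mul]
  congr 1
  · simp [sq]
  · refine Finset.sum_congr rfl fun g _ => ?_
    rw [Finset.mul_sum, Finset.sum_mul]
    refine Finset.sum_congr rfl fun w _ => ?_
    rw [Matrix.mul_smul, Matrix.smul_mul]

open Classical in
/-- A sum against a function on `S_{n-2} \ S_n` is a combination of averages over the seven double
cosets, for functions invariant under `S_{n-2}` on the right. -/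
theorem exists_sum_mul_eq (hn : 4 ≤ n) (Φ : Equiv.Perm (Fin n) → ℂ)
    (hΦ : ∀ h ∈ subSym n, ∀ w, Φ (h * w) = Φ w) : ∃ c : Fin 7 → ℂ,
    ∀ F : Equiv.Perm (Fin n) → ℂ, (∀ g, ∀ h ∈ subSym n, F (g * h) = F g) → ∀ g,
      ∑ w, F (g * w) * Φ w = ∑ D, c D * ∑ h : subSym n, F (g * h * doubleCosetRep hn D) := by
  choose D h hh h' hh' hw using exists_doubleCosetRep hn
  have hcard : (Fintype.card (subSym n) : ℂ) ≠ 0 := Nat.cast_ne_zero.2 Fintype.card_ne_zero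
  refine ⟨fun E => (1 / (Fintype.card (subSym n) : ℂ)) *
    ∑ w ∈ Finset.univ.filter (fun w => D w = E), Φ w, fun F hF g => ?_⟩
  have h1 : ∀ k : subSym n, ∑ w, F (g * (k * w)) * Φ w = ∑ w, F (g * w) * Φ w := by
    intro k
    refine Fintype.sum_equiv (Equiv.mulLeft (k : Equiv.Perm (Fin n))) _ _ fun w => ?_
    rw [Equiv.coe_mulLeft, hΦ k k.2]
  have h2 : ∀ w, ∑ k : subSym n, F (g * (k * w)) =
      ∑ k : subSym n, F (g * k * doubleCosetRep hn (D w)) := by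
    intro w
    refine Fintype.sum_equiv (Equiv.mulRight (⟨h w, hh w⟩ : subSym n)) _ _ fun k => ?_
    conv_lhs => rw [hw w]
    simp only [Equiv.coe_mulRight, Subgroup.coe_mul, ← mul_assoc]
    exact hF _ _ (hh' w)
  have h3 : (Fintype.card (subSym n) : ℂ) * ∑ w, F (g * w) * Φ w =
      ∑ w, (∑ k : subSym n, F (g * k * doubleCosetRep hn (D w))) * Φ w := by
    rw [← nsmul_eq_mul, ← Finset.card_univ, ← Finset.sum_const, ← Finset.sum_congr rfl
      fun k _ => h1 k, Finset.sum_comm]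
    refine Finset.sum_congr rfl fun w _ => ?_
    rw [← h2, Finset.sum_mul]
  rw [← mul_right_inj' hcard, h3, ← Finset.sum_fiberwise_of_maps_to (g := D) (t := Finset.univ)
    (fun _ _ => Finset.mem_univ _), Finset.mul_sum]
  refine Finset.sum_congr rfl fun E _ => ?_
  rw [Finset.sum_congr rfl (g := fun w =>
    (∑ k : subSym n, F (g * k * doubleCosetRep hn E)) * Φ w)
    (fun w hw => by rw [(Finset.mem_filter.1 hw).2]), ← Finset.mul_sum]
  field_simp

open Classical in
/-- Averaging the first of two factors over the cosets of `S_{n-2}`, on which the second is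
constant. -/
theorem card_mul_sum_eq (F A : Equiv.Perm (Fin n) → ℂ)
    (hA : ∀ g, ∀ h ∈ subSym n, A (g * h) = A g) :
    (Fintype.card (subSym n) : ℂ) * ∑ g, star (F g) * A g =
      ∑ g, star (∑ h : subSym n, F (g * h)) * A g := by
  have h1 : ∀ h : subSym n, ∑ g, star (F (g * h)) * A g = ∑ g, star (F g) * A g := by
    intro h
    refine Fintype.sum_equiv (Equiv.mulRight (h : Equiv.Perm (Fin n))) _ _ fun g => ?_
    rw [Equiv.coe_mulRight, hA g h h.2]
  rw [← nsmul_eq_mul, ← Finset.card_univ, ← Finset.sum_const, ← Finset.sum_congr rfl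
    fun h _ => h1 h, Finset.sum_comm]
  refine Finset.sum_congr rfl fun g _ => ?_
  rw [star_sum, Finset.sum_mul]

/-- The contribution of one double coset to an entry of the spectrum. -/
def entrySum (hn : 4 ≤ n) (f : Coset n → Fin d → ℂ) {m : ℕ} (e : Fin m ↪o Fin 7)
    (I : Fin (m + 1) → Fin d) (i : Fin d) (D : Fin 7) : ℂ :=
  ∑ x, ∑ y, star (pairVal hn f (some (I (Fin.last m))) x y * pairSum hn f (embIdx e I) x y) *
    pairSum hn f (singleIdx D i) x y

/-- Every entry of a diagonal block is a combination of seven sums over pairs of letters, whose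
coefficients do not depend on `f`. -/
theorem exists_doublyReducedSpectrum_eq (hn : 4 ≤ n) {m : ℕ} (p : Position n d m)
    (hp : p.row.2 = p.col.2) : ∃ c : Fin 7 → ℂ, ∀ f : Coset n → Fin d → ℂ,
    doublyReducedSpectrum hn f p =
      ∑ D, c D * entrySum hn f p.elems (fun l => p.row.2 l.castSucc)
        (p.row.2 (Fin.last (m + 1))) D := by
  classical
  set Φ : Equiv.Perm (Fin n) → ℂ := fun w =>
    (tau n p.shape * yor p.shape w * tau n p.shape) p.row.1 p.col.1 with hΦdef
  have hΦ : ∀ h ∈ subSym n, ∀ w, Φ (h * w) = Φ w := by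
    intro h hh w
    simp only [hΦdef]
    rw [yor_mul, ← Matrix.mul_assoc, tau_mul_yor hh]
  obtain ⟨c, hc⟩ := exists_sum_mul_eq hn Φ hΦ
  obtain ⟨N, hN⟩ := exists_cosetSum_eq hn
  obtain ⟨M, hM⟩ := exists_sum_perm_eq hn
  have hcard : (Fintype.card (subSym n) : ℂ) ≠ 0 := Nat.cast_ne_zero.2 Fintype.card_ne_zero
  set κ : ℂ := 1 / (Fintype.card (Equiv.Perm (Fin n)) : ℂ) with hκ
  refine ⟨fun D => κ ^ 2 * (1 / (Fintype.card (subSym n) : ℂ)) * (c D * (star N * N * M)),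
    fun f => ?_⟩
  set I : Fin (m + 1) → Fin d := fun l => p.row.2 l.castSucc with hI
  set i := p.row.2 (Fin.last (m + 1)) with hi
  set F : Equiv.Perm (Fin n) → ℂ := fun g => comp f (I (Fin.last m)) g *
    ∏ l : Fin m, comp f (I l.castSucc) (g * doubleCosetRep hn (p.elems l)) with hF
  have hinv : ∀ g, ∀ h ∈ subSym n, comp f i (g * h) = comp f i g :=
    fun g h hh => comp_mul_subSym f i g hh
  have hA : ∀ g, ∑ w, comp f i (g * w) * Φ w = ∑ D, c D * cosetSum hn f (singleIdx D i) g := by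
    intro g
    rw [hc _ hinv g]
    refine Finset.sum_congr rfl fun D _ => ?_
    rw [cosetSum_singleIdx]
  have hFsum : ∀ g, ∑ h : subSym n, F (g * h) =
      comp f (I (Fin.last m)) g * cosetSum hn f (embIdx p.elems I) g := by
    intro g
    rw [cosetSum_embIdx, Finset.mul_sum]
    refine Finset.sum_congr rfl fun h _ => ?_
    rw [hF]
    simp only
    rw [comp_mul_subSym f _ g h.2]
  have hAinv : ∀ g, ∀ h ∈ subSym n, ∑ w, comp f i (g * h * w) * Φ w =
      ∑ w, comp f i (g * w) * Φ w := by
    intro g h hh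
    refine Fintype.sum_equiv (Equiv.mulLeft h) _ _ fun w => ?_
    rw [Equiv.coe_mulLeft, hΦ h hh, mul_assoc]
  have hentry : doublyReducedSpectrum hn f p =
      κ ^ 2 * ∑ g, star (F g) * ∑ w, comp f i (g * w) * Φ w := by
    unfold doublyReducedSpectrum reducedSpectrum
    rw [Matrix.blockDiagonal_apply, if_pos hp, sHat_conjTranspose_mul_fourier, rHat,
      tau_mul_fourier_mul_tau]
    rw [Matrix.smul_apply, smul_eq_mul, Matrix.sum_apply]
    congr 1
    refine Finset.sum_congr rfl fun g _ => ?_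
    rw [Matrix.sum_apply, Finset.mul_sum]
    refine Finset.sum_congr rfl fun w _ => ?_
    rw [Matrix.smul_apply, smul_eq_mul, mul_assoc]
  have hcs := card_mul_sum_eq F (fun g => ∑ w, comp f i (g * w) * Φ w) hAinv
  have hsum : ∑ g, star (∑ h : subSym n, F (g * h)) * ∑ w, comp f i (g * w) * Φ w =
      ∑ D, c D * (star N * N * M) * entrySum hn f p.elems I i D := by
    have h1 : ∀ g, star (∑ h : subSym n, F (g * h)) * ∑ w, comp f i (g * w) * Φ w =
        ∑ D, c D * (star N * N) * (star (pairVal hn f (some (I (Fin.last m)))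
          (g (letter hn 1)) (g (letter hn 0)) *
          pairSum hn f (embIdx p.elems I) (g (letter hn 1)) (g (letter hn 0))) *
          pairSum hn f (singleIdx D i) (g (letter hn 1)) (g (letter hn 0))) := by
      intro g
      have : comp f (I (Fin.last m)) g = optComp f (some (I (Fin.last m))) g := rfl
      rw [hA, hFsum, this, optComp_eq hn, hN, Finset.mul_sum]
      refine Finset.sum_congr rfl fun D _ => ?_
      rw [hN]
      simp only [star_mul']
      ring
    rw [Finset.sum_congr rfl fun g _ => h1 g, Finset.sum_comm]
    refine Finset.sum_congr rfl fun D _ => ?_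
    rw [← Finset.mul_sum, hM (fun x y => star (pairVal hn f (some (I (Fin.last m))) x y *
      pairSum hn f (embIdx p.elems I) x y) * pairSum hn f (singleIdx D i) x y)
      (fun x => by simp [pairVal_self]), entrySum]
    ring
  rw [hsum] at hcs
  rw [hentry, eq_div_of_mul_eq hcard ((mul_comm _ _).trans hcs), div_eq_mul_one_div,
    Finset.sum_mul, Finset.mul_sum]
  refine Finset.sum_congr rfl fun D _ => ?_
  ring

end Entries

/-! ### Operation counts -/

section Programs

variable {ι : Type}

theorem run_append_singleton (P : Program ι) (o : Op ι) (x : ι → ℂ) :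
    Program.run (P ++ [o]) x = P.run x ++ [o.eval x (P.run x)] := by
  simp [Program.run, List.foldl_append]

theorem length_run (P : Program ι) (x : ι → ℂ) : (P.run x).length = P.length := by
  induction P using List.reverseRecOn with
  | nil => rfl
  | append_singleton P o ih => rw [run_append_singleton]; simp [ih]

theorem getD_run_append (P Q : Program ι) (x : ι → ℂ) {r : ℕ} (hr : r < P.length) :
    (Program.run (P ++ Q) x).getD r 0 = (P.run x).getD r 0 := by
  induction Q using List.reverseRecOn with
  | nil => rw [List.append_nil]
  | append_singleton Q o ih =>
    rw [← List.append_assoc, run_append_singleton, List.getD_append _ _ _ _ (by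
      rw [length_run, List.length_append]; omega), ih]

/-- The function `φ` of the input is one of the results of the program `P`. -/
def Avail (P : Program ι) (φ : (ι → ℂ) → ℂ) : Prop :=
  ∃ r < P.length, ∀ x, (P.run x).getD r 0 = φ x

theorem Avail.append {P : Program ι} {φ : (ι → ℂ) → ℂ} (h : Avail P φ) (Q : Program ι) :
    Avail (P ++ Q) φ := by
  obtain ⟨r, hr, e⟩ := h
  exact ⟨r, by rw [List.length_append]; omega, fun x => by rw [getD_run_append P Q x hr, e]⟩

theorem avail_append_singleton (P : Program ι) (o : Op ι) {φ : (ι → ℂ) → ℂ}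
    (h : ∀ x, o.eval x (P.run x) = φ x) : Avail (P ++ [o]) φ := by
  refine ⟨P.length, by simp, fun x => ?_⟩
  rw [run_append_singleton, List.getD_append_right _ _ _ _ (by rw [length_run]), length_run,
    Nat.sub_self]
  exact h x

/-- Once the functions in `S` have been computed, those in `T` take at most `c` more operations. -/
def Cost (S T : Set ((ι → ℂ) → ℂ)) (c : ℕ) : Prop :=
  ∀ P : Program ι, (∀ φ ∈ S, Avail P φ) →
    ∃ Q : Program ι, Q.length ≤ c ∧ ∀ φ ∈ T, Avail (P ++ Q) φ

variable {S S' T T' U : Set ((ι → ℂ) → ℂ)} {φ ψ : (ι → ℂ) → ℂ} {c c' : ℕ}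

theorem Cost.mono (h : Cost S T c) (hS : S ⊆ S') (hc : c ≤ c') : Cost S' T c' := by
  intro P hP
  obtain ⟨Q, hQ, hT⟩ := h P fun φ hφ => hP φ (hS hφ)
  exact ⟨Q, hQ.trans hc, hT⟩

theorem Cost.trans (h : Cost S T c) (h' : Cost (S ∪ T) U c') : Cost S (T ∪ U) (c + c') := by
  intro P hP
  obtain ⟨Q, hQ, hT⟩ := h P hP
  obtain ⟨R, hR, hU⟩ := h' (P ++ Q) (by
    rintro φ (hφ | hφ)
    · exact (hP φ hφ).append Q
    · exact hT φ hφ)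
  refine ⟨Q ++ R, by rw [List.length_append]; omega, ?_⟩
  rw [← List.append_assoc]
  rintro φ (hφ | hφ)
  · exact (hT φ hφ).append R
  · exact hU φ hφ

/-- Fewer results may be asked for. -/
theorem Cost.subset (h : Cost S T c) (hT : T' ⊆ T) : Cost S T' c := by
  intro P hP
  obtain ⟨Q, hQ, hQT⟩ := h P hP
  exact ⟨Q, hQ, fun φ hφ => hQT φ (hT hφ)⟩

theorem cost_empty : Cost S ∅ 0 := fun _ _ => ⟨[], le_rfl, by simp⟩

theorem cost_of_mem (h : φ ∈ S) : Cost S {φ} 0 := by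
  intro P hP
  refine ⟨[], le_rfl, ?_⟩
  rintro _ rfl
  rw [List.append_nil]
  exact hP _ h

theorem cost_input (i : ι) : Cost S {fun x => x i} 1 := by
  intro P _
  refine ⟨[.input i], le_rfl, ?_⟩
  rintro _ rfl
  exact avail_append_singleton P _ fun x => rfl

theorem cost_const (z : ℂ) : Cost S {fun _ => z} 1 := by
  intro P _
  refine ⟨[.const z], le_rfl, ?_⟩
  rintro _ rfl
  exact avail_append_singleton P _ fun x => rfl

/-- One operation applied to two available results; `f` is the operation's effect on values. -/
theorem cost_binary_of_mem {f : ℂ → ℂ → ℂ} (hf : ∀ a b, ∃ o : Op ι, ∀ x v,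
    o.eval x v = f (v.getD a 0) (v.getD b 0)) (hφ : φ ∈ S) (hψ : ψ ∈ S) :
    Cost S {fun x => f (φ x) (ψ x)} 1 := by
  intro P hP
  obtain ⟨a, -, ha⟩ := hP φ hφ
  obtain ⟨b, -, hb⟩ := hP ψ hψ
  obtain ⟨o, ho⟩ := hf a b
  refine ⟨[o], le_rfl, ?_⟩
  rintro _ rfl
  exact avail_append_singleton P _ fun x => by rw [ho, ha, hb]

theorem Cost.binary {f : ℂ → ℂ → ℂ} (hf : ∀ a b, ∃ o : Op ι, ∀ x v,
    o.eval x v = f (v.getD a 0) (v.getD b 0)) (hφ : Cost S {φ} c) (hψ : Cost S {ψ} c') :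
    Cost S {fun x => f (φ x) (ψ x)} (c + c' + 1) :=
  ((hφ.trans (hψ.mono Set.subset_union_left le_rfl)).trans
    (cost_binary_of_mem hf (by simp) (by simp))).subset Set.subset_union_right

theorem Cost.add (hφ : Cost S {φ} c) (hψ : Cost S {ψ} c') :
    Cost S {fun x => φ x + ψ x} (c + c' + 1) :=
  hφ.binary (f := (· + ·)) (fun a b => ⟨.add a b, fun _ _ => rfl⟩) hψ

theorem Cost.sub (hφ : Cost S {φ} c) (hψ : Cost S {ψ} c') :
    Cost S {fun x => φ x - ψ x} (c + c' + 1) :=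
  hφ.binary (f := (· - ·)) (fun a b => ⟨.sub a b, fun _ _ => rfl⟩) hψ

theorem Cost.mul (hφ : Cost S {φ} c) (hψ : Cost S {ψ} c') :
    Cost S {fun x => φ x * ψ x} (c + c' + 1) :=
  hφ.binary (f := (· * ·)) (fun a b => ⟨.mul a b, fun _ _ => rfl⟩) hψ

theorem Cost.star (hφ : Cost S {φ} c) : Cost S {fun x => star (φ x)} (c + 1) := by
  have h : Cost (S ∪ {φ}) {fun x => Star.star (φ x)} 1 := by
    intro P hP
    obtain ⟨a, -, ha⟩ := hP φ (by simp)
    refine ⟨[.conj a], le_rfl, ?_⟩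
    rintro _ rfl
    exact avail_append_singleton P _ fun x => by rw [Op.eval, ha]; rfl
  exact (hφ.trans h).subset Set.subset_union_right

theorem Cost.sum {κ : Type*} (s : Finset κ) {φ : κ → (ι → ℂ) → ℂ} (h : ∀ k, Cost S {φ k} c) :
    Cost S {fun x => ∑ k ∈ s, φ k x} (s.card * (c + 1) + 1) := by
  classical
  induction s using Finset.induction_on with
  | empty => simpa using cost_const (S := S) 0
  | insert a s ha ih =>
    simp only [Finset.sum_insert ha, Finset.card_insert_of_notMem ha]
    exact ((h a).add ih).mono le_rfl (by ring_nf; omega)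

/-- The cost of a finite family of functions. -/
theorem Cost.range {κ : Type*} [Finite κ] {φ : κ → (ι → ℂ) → ℂ} (h : ∀ k, Cost S {φ k} c) :
    Cost S (Set.range φ) (Nat.card κ * c) := by
  classical
  have := Fintype.ofFinite κ
  have key : ∀ s : Finset κ, Cost S (φ '' s) (s.card * c) := by
    intro s
    induction s using Finset.induction_on with
    | empty => simpa using cost_empty (S := S)
    | insert a s ha ih =>
      rw [Finset.card_insert_of_notMem ha, Finset.coe_insert, Set.image_insert_eq,
        Set.insert_eq, Set.union_comm, add_mul, one_mul]
      exact ih.trans ((h a).mono Set.subset_union_left le_rfl)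
  have := key Finset.univ
  rwa [Finset.coe_univ, Set.image_univ, Finset.card_univ, ← Nat.card_eq_fintype_card] at this

end Programs

/-! ### The program for the spectrum -/

section Algorithm

variable {n d : ℕ}

/-- The function on `S_n / S_{n-2}` given by the input values of a program. -/
def inputFun (x : Coset n × Fin d → ℂ) : Coset n → Fin d → ℂ := fun y i => x (y, i)

theorem cost_pairVal (hn : 4 ≤ n) (o : Option (Fin d)) (a b : Fin n)
    {S : Set ((Coset n × Fin d → ℂ) → ℂ)} :
    Cost S {fun x => pairVal hn (inputFun x) o a b} 1 := by
  unfold pairVal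
  by_cases h : a = b
  · simp only [if_pos h]
    exact cost_const 0
  · simp only [if_neg h]
    cases o with
    | none => exact cost_const 1
    | some i => exact cost_input (pairCoset hn a b, i)

/-- The results of the first phase: the values and the row sums of all components. -/
def valueSet (hn : 4 ≤ n) (d : ℕ) : Set ((Coset n × Fin d → ℂ) → ℂ) :=
  (Set.range fun z : Option (Fin d) × Fin n × Fin n =>
    fun x => pairVal hn (inputFun x) z.1 z.2.1 z.2.2) ∪
  Set.range fun z : Option (Fin d) × Fin n => fun x => rowSum hn (inputFun x) z.1 z.2

theorem cost_valueSet (hn : 4 ≤ n) : Cost ∅ (valueSet hn d)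
    ((d + 1) * (n * n) + (d + 1) * n * (n + 1)) := by
  have h1 : Cost ∅ (Set.range fun z : Option (Fin d) × Fin n × Fin n =>
      fun x => pairVal hn (inputFun x) z.1 z.2.1 z.2.2) ((d + 1) * (n * n)) := by
    have := Cost.range (S := ∅) fun z : Option (Fin d) × Fin n × Fin n =>
      cost_pairVal hn z.1 z.2.1 z.2.2
    simpa [Nat.card_eq_fintype_card] using this
  refine h1.trans ?_
  have h2 := Cost.range (κ := Option (Fin d) × Fin n) fun z =>
    Cost.sum (Finset.univ : Finset (Fin n)) fun q => cost_of_mem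
      (S := ∅ ∪ Set.range fun z : Option (Fin d) × Fin n × Fin n =>
        fun x => pairVal hn (inputFun x) z.1 z.2.1 z.2.2)
      (φ := fun x => pairVal hn (inputFun x) z.1 q z.2) (Or.inr ⟨(z.1, q, z.2), rfl⟩)
  simpa [Nat.card_eq_fintype_card, rowSum] using h2

/-- A value of `pairSum` takes `O(n)` operations once the row sums are known. -/
theorem cost_pairSum (hn : 4 ≤ n) (J : Fin 7 → Option (Fin d)) (a b : Fin n) :
    Cost (valueSet hn d) {fun x => pairSum hn (inputFun x) J a b} (7 * n + 3) := by
  have hv : ∀ o a b, Cost (valueSet hn d) {fun x => pairVal hn (inputFun x) o a b} 0 :=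
    fun o a b => cost_of_mem (Or.inl ⟨(o, a, b), rfl⟩)
  have hr : ∀ o p, Cost (valueSet hn d) {fun x => rowSum hn (inputFun x) o p} 0 :=
    fun o p => cost_of_mem (Or.inr ⟨(o, p), rfl⟩)
  have ht : ∀ p, Cost (valueSet hn d) {fun x => pairTerm hn (inputFun x) J a b p} 6 :=
    fun p => (((hv _ _ _).mul (hv _ _ _)).mul ((hv _ _ _).mul (hv _ _ _))).mul
      (((hr _ _).sub (hv _ _ _)).sub (hv _ _ _))
  have := ((hv (J 0) a b).mul (hv (J 1) b a)).mul (Cost.sum Finset.univ ht)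
  exact this.mono le_rfl (by rw [Finset.card_univ, Fintype.card_fin]; omega)

/-- The indices of the functions of the second phase: products of translates of `k - 2` components,
and single translates. -/
abbrev PairIdx (d m : ℕ) : Type :=
  (Fin m ↪o Fin 7) × (Fin (m + 1) → Fin d) ⊕ Fin 7 × Fin d

/-- The assignment of components to representatives that belongs to an index. -/
def PairIdx.toFun {m : ℕ} : PairIdx d m → Fin 7 → Option (Fin d) :=
  Sum.elim (fun z => embIdx z.1 z.2) fun z => singleIdx z.1 z.2

/-- The choices of representatives are bounded, whatever their number `m`. -/
theorem card_orderEmbedding_le (m : ℕ) : Nat.card (Fin m ↪o Fin 7) ≤ 128 := by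
  have : Function.Injective
      fun e : Fin m ↪o Fin 7 => (Finset.univ.map e.toEmbedding : Finset (Fin 7)) := by
    intro e e' h
    refine DFunLike.coe_injective ((e.strictMono.range_inj e'.strictMono).1 ?_)
    have := congrArg (fun s : Finset (Fin 7) => (s : Set (Fin 7))) h
    simpa using this
  have := Nat.card_le_card_of_injective _ this
  simpa [Nat.card_eq_fintype_card] using this

/-- The results of the second phase. -/
def sumSet (hn : 4 ≤ n) (d m : ℕ) : Set ((Coset n × Fin d → ℂ) → ℂ) :=
  Set.range fun z : PairIdx d m × Fin n × Fin n =>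
    fun x => pairSum hn (inputFun x) z.1.toFun z.2.1 z.2.2

/-- The first factor of a summand of `entrySum`. -/
def conjTerm (hn : 4 ≤ n) {m : ℕ} (e : Fin m ↪o Fin 7) (I : Fin (m + 1) → Fin d) (a b : Fin n)
    (x : Coset n × Fin d → ℂ) : ℂ :=
  star (pairVal hn (inputFun x) (some (I (Fin.last m))) a b *
    pairSum hn (inputFun x) (embIdx e I) a b)

/-- The results of the third phase. -/
def conjSet (hn : 4 ≤ n) (d m : ℕ) : Set ((Coset n × Fin d → ℂ) → ℂ) :=
  Set.range fun z : ((Fin m ↪o Fin 7) × (Fin (m + 1) → Fin d)) × Fin n × Fin n =>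
    conjTerm hn z.1.1 z.1.2 z.2.1 z.2.2

theorem cost_sumSet (hn : 4 ≤ n) (d m : ℕ) : Cost (valueSet hn d) (sumSet hn d m)
    ((128 * d ^ (m + 1) + 7 * d) * (n * n) * (7 * n + 3)) := by
  refine (Cost.range fun z : PairIdx d m × Fin n × Fin n =>
    cost_pairSum hn z.1.toFun z.2.1 z.2.2).mono le_rfl ?_
  have := card_orderEmbedding_le m
  simp only [Nat.card_prod, Nat.card_sum, Nat.card_fun, Nat.card_fin]
  gcongr

theorem cost_conjSet (hn : 4 ≤ n) (d m : ℕ) :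
    Cost (valueSet hn d ∪ sumSet hn d m) (conjSet hn d m)
      (128 * d ^ (m + 1) * (n * n) * 2) := by
  have h : ∀ z : ((Fin m ↪o Fin 7) × (Fin (m + 1) → Fin d)) × Fin n × Fin n,
      Cost (valueSet hn d ∪ sumSet hn d m) {conjTerm hn z.1.1 z.1.2 z.2.1 z.2.2} 2 := by
    intro z
    refine Cost.star (c := 1) (Cost.mul (c := 0) (c' := 0) (cost_of_mem ?_) (cost_of_mem ?_))
    · exact Or.inl (Or.inl ⟨(_, _, _), rfl⟩)
    · exact Or.inr ⟨(Sum.inl z.1, _, _), rfl⟩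
  refine (Cost.range h).mono le_rfl ?_
  have := card_orderEmbedding_le m
  simp only [Nat.card_prod, Nat.card_fun, Nat.card_fin]
  gcongr

/-- An essential entry takes `O(n^2)` operations once the results of all phases are
known. -/
theorem cost_entry (hn : 4 ≤ n) {m : ℕ} {p : Position n d m} (hp : Essential p) :
    Cost (valueSet hn d ∪ (sumSet hn d m ∪ conjSet hn d m))
      {fun x => doublyReducedSpectrum hn (inputFun x) p} (7 * (2 * (n * n) + 2 * n + 4) + 1) := by
  obtain ⟨c, hc⟩ := exists_doublyReducedSpectrum_eq hn p hp.1
  simp only [hc]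
  have h1 : ∀ D, Cost (valueSet hn d ∪ (sumSet hn d m ∪ conjSet hn d m))
      {fun x => entrySum hn (inputFun x) p.elems (fun l => p.row.2 l.castSucc)
        (p.row.2 (Fin.last (m + 1))) D} (2 * (n * n) + 2 * n + 1) := by
    intro D
    have ht : ∀ a b, Cost (valueSet hn d ∪ (sumSet hn d m ∪ conjSet hn d m))
        {fun x => conjTerm hn p.elems (fun l => p.row.2 l.castSucc) a b x *
          pairSum hn (inputFun x) (singleIdx D (p.row.2 (Fin.last (m + 1)))) a b} 1 :=
      fun a b => Cost.mul (c := 0) (c' := 0)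
        (cost_of_mem (Or.inr (Or.inr ⟨((_, _), _, _), rfl⟩)))
        (cost_of_mem (Or.inr (Or.inl ⟨(Sum.inr (D, _), _, _), rfl⟩)))
    have := Cost.sum Finset.univ fun a => Cost.sum Finset.univ fun b => ht a b
    refine Cost.mono this le_rfl ?_
    rw [Finset.card_univ, Fintype.card_fin]
    ring_nf
    omega
  have h2 := Cost.sum Finset.univ fun D => (cost_const (c D)).mul (h1 D)
  refine h2.mono le_rfl ?_
  rw [Finset.card_univ, Fintype.card_fin]
  omega

/-- The program runs through three phases and then computes each essential entry; the other
entries are declared to be zero. -/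
theorem exists_program (hn : 4 ≤ n) (d m : ℕ) : ∃ P : Program (Coset n × Fin d),
    P.length ≤ 100000 * (d ^ (m + 1) * n ^ 3 + d ^ (m + 2) * n ^ 2) ∧
    P.Computes fun x => doublyReducedSpectrum (m := m) hn fun y i => x (y, i) := by
  classical
  rcases Nat.eq_zero_or_pos d with rfl | hd
  · exact ⟨[], Nat.zero_le _, fun _ => none, fun x p => (p.row.2 0).elim0⟩
  have hfin : {p : Position n d m | Essential p}.Finite :=
    Set.finite_of_encard_le_coe (encard_essential_le hn d m)
  have : Finite {p : Position n d m // Essential p} := hfin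
  have hcard : Nat.card {p : Position n d m // Essential p} ≤ 128 * 7 * d ^ (m + 2) := by
    have h1 := encard_essential_le hn d m
    rw [← hfin.cast_ncard_eq] at h1
    have h2 : {p : Position n d m | Essential p}.ncard ≤ Nat.choose 7 m * 7 * d ^ (m + 2) := by
      exact_mod_cast h1
    have h3 : Nat.choose 7 m ≤ 128 := Nat.choose_le_two_pow 7 m
    exact h2.trans (by gcongr)
  have h := (cost_valueSet (d := d) hn).trans (((cost_sumSet hn d m).mono
    Set.subset_union_right le_rfl).trans (((cost_conjSet hn d m).mono (by
      intro φ hφ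
      rcases hφ with hφ | hφ
      · exact Or.inl (Or.inr hφ)
      · exact Or.inr hφ) le_rfl)))
  have h' := h.trans ((Cost.range fun p : {p : Position n d m // Essential p} =>
    cost_entry hn p.2).mono Set.subset_union_right le_rfl)
  -- Run the phases from the empty program, then compute each essential entry.
  obtain ⟨P, hP, hout⟩ := h' [] (by simp)
  rw [List.nil_append] at hout
  refine ⟨P, hP.trans ?_, ?_⟩
  · have e1 : d ≤ d ^ (m + 1) := Nat.le_self_pow (by omega) d
    have e2 : 1 ≤ d ^ (m + 1) := Nat.one_le_pow _ _ hd
    have e3 : n ≤ n ^ 2 := Nat.le_self_pow (by omega) n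
    have e4 : n ^ 2 ≤ n ^ 3 := Nat.pow_le_pow_right (by omega) (by omega)
    have e5 : 1 ≤ n ^ 2 := Nat.one_le_pow _ _ (by omega)
    have e6 : n ^ 2 = n * n := sq n
    generalize Nat.card {p : Position n d m // Essential p} = N at hcard
    have g1 : (d + 1) * (n * n) + (d + 1) * n * (n + 1) ≤ 6 * (d ^ (m + 1) * n ^ 3) := by
      calc (d + 1) * (n * n) + (d + 1) * n * (n + 1) = (d + 1) * (2 * n ^ 2 + n) := by ring
        _ ≤ (2 * d ^ (m + 1)) * (3 * n ^ 3) := Nat.mul_le_mul (by omega) (by omega)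
        _ = _ := by ring
    have g2 : (128 * d ^ (m + 1) + 7 * d) * (n * n) * (7 * n + 3) ≤
        1350 * (d ^ (m + 1) * n ^ 3) := by
      calc (128 * d ^ (m + 1) + 7 * d) * (n * n) * (7 * n + 3)
          ≤ (135 * d ^ (m + 1)) * (n * n) * (10 * n) := by gcongr <;> omega
        _ = _ := by ring
    have g3 : 128 * d ^ (m + 1) * (n * n) * 2 ≤ 256 * (d ^ (m + 1) * n ^ 3) := by
      calc 128 * d ^ (m + 1) * (n * n) * 2 = 256 * (d ^ (m + 1) * n ^ 2) := by ring
        _ ≤ _ := by gcongr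
    have g4 : N * (7 * (2 * (n * n) + 2 * n + 4) + 1) ≤ 51072 * (d ^ (m + 2) * n ^ 2) := by
      calc N * (7 * (2 * (n * n) + 2 * n + 4) + 1)
          ≤ (128 * 7 * d ^ (m + 2)) * (57 * n ^ 2) := Nat.mul_le_mul hcard (by omega)
        _ = _ := by ring
    omega
  · have hav : ∀ p : {p : Position n d m // Essential p},
        Avail P fun x => doublyReducedSpectrum hn (inputFun x) p.1 :=
      fun p => hout _ (Or.inr ⟨p, rfl⟩)
    choose r _ hr using hav
    refine ⟨fun p => if hp : Essential p then some (r ⟨p, hp⟩) else none, fun x p => ?_⟩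
    by_cases hp : Essential p
    · simp only [dif_pos hp, Option.elim_some]
      exact (hr ⟨p, hp⟩ x).symm
    · simp only [dif_neg hp, Option.elim_none]
      exact doublyReducedSpectrum_eq_zero hn _ hp

end Algorithm

end

end KSpectrum

theorem mainTheorem3 :
    ∃ C : ℕ, ∀ (k n d : ℕ) (_ : 2 ≤ k) (hn : 4 ≤ n),
      (∃ P : KSpectrum.Program (KSpectrum.Coset n × Fin d),
        P.length ≤ C * (d ^ (k - 1) * n ^ 3 + d ^ k * n ^ 2) ∧
        P.Computes (fun x => KSpectrum.doublyReducedSpectrum (m := k - 2) hn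
          (fun y i => x (y, i)))) ∧
      ∀ f : KSpectrum.Coset n → Fin d → ℂ,
        {p : KSpectrum.Position n d (k - 2) |
            KSpectrum.doublyReducedSpectrum hn f p ≠ 0}.encard
          ≤ ((Nat.choose 7 (k - 2) * 7 * d ^ k : ℕ) : ℕ∞) := by
  refine ⟨100000, fun k n d hk hn => ?_⟩
  obtain ⟨m, rfl⟩ : ∃ m, k = m + 2 := ⟨k - 2, by omega⟩
  refine ⟨KSpectrum.exists_program hn d m, fun f => ?_⟩
  refine (Set.encard_le_encard fun p hp => ?_).trans (KSpectrum.encard_essential_le hn d m)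
  by_contra h
  exact hp (KSpectrum.doublyReducedSpectrum_eq_zero hn f h)
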